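/- Let $m\ge 1$ and let $(X_{n,i})_{1\le i\le n,\ n\ge 1}$ be a triangular array of random vectors in $\mathbb{R}^m$ on a measurable space; write $X_i$ for $X_{n,i}$. A DGP is a probability measure $\mathbf P$ on this space under which, for each $n$, $X_1,\dots,X_n$ are identically distributed (possibly dependent) and integrable; put $\mu_0(\mathbf P)=\mathbf E_{\mathbf P}[X_1]$ (which may depend on $n$). Let $\bar X=n^{-1}\sum_{i=1}^n X_i$ and $\hat\Sigma=n^{-1}\sum_{i=1}^n (X_i-\bar X)(X_i-\bar X)'$. Let $R_n$ be positive integers and, independently of the data, let $\pi=(\pi_r)_{r=1}^{R_n}$ be i.i.d. uniform random permutations of $\{1,\dots,n\}$. For $1\le k\le m$ and $\mu\in\mathbb R$ let $$T_{U,k}(\mu;\pi)=\frac1{\sqrt{mR_n}}\sum_{r=1}^{R_n}(X_{\pi_r(1),k}-\mu)\,\hat\Sigma_{kk}^{-1}\,(X_{\pi_r(2),k}-\mu),$$ $$\hat\lambda_k=\bar X_k\hat\Sigma_{kk}^{-1}\frac1{\sqrt{mR_n}}\sum_{r=1}^{R_n}(X_{\pi_r(1),k}+X_{\pi_r(2),k})-\sqrt{\frac{R_n}{m}}\,\hat\Sigma_{kk}^{-1}\bar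 X_k^2,$$ $$Q_n(\pi)=\max_{1\le k\le m}\{T_{U,k}(0;\pi)-\hat\lambda_k\mathbf 1\{\bar X_k<0\}\},\qquad \tilde Q_n(\pi)=\max_{1\le k\le m}T_{U,k}(\bar X_k;\pi).$$ For $\alpha\in(0,1)$ let $c_{1-\alpha}$ be the $(1-\alpha)$-quantile of the distribution of $\tilde Q_n(\pi)$ conditional on the data, and let $\phi_n=\mathbf 1\{Q_n(\pi)>c_{1-\alpha}\}$. Let $\mathcal P_0$ be a nonempty set of DGPs for which there are $\delta,L,U\in(0,\infty)$ such that every sequence $\{\mathbf P_n\}\subseteq\mathcal P_0$ satisfies, as $n\to\infty$ with the sample of size $n$ drawn from $\mathbf P_n$: (a) $n^{-1/2}\sum_{i=1}^n (X_i-\mu_0(\mathbf P_n))=O_{\mathbf P_n}(1)$; (b) there are symmetric matrices $\Sigma_n$ (for instance, a fixed matrix $\Sigma_n=\Sigma$) with $\max_{i,j}|(\Sigma_n)_{ij}|<U$ and $\lambda_{\min}(\Sigma_n)>L$ for all $n$, such that $\hat\Sigma-\Sigma_n\to 0$ in $\mathbf P_n$-probability; (c) $n^{-1}\sum_{i=1}^n\|X_i\|^{2+\delta}=O_{\mathbf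 P_n}(1)$, where $\|\cdot\|$ is the sup norm; (d) $\mu_0(\mathbf P_n)\le 0$ componentwise for all $n$. If $R_n\to\infty$ and $\sqrt{R_n}/n\to 0$, then $$\sup_{\mathbf P\in\mathcal P_0}\mathbf E_{\mathbf P}[\phi_n]\longrightarrow\alpha .$$ -/

import Mathlib

open MeasureTheory ProbabilityTheory Filter Topology

namespace ResampledMI

noncomputable section

/-! ### Statistics of a data set

A data set of size `n` is `x : Fin n → Fin m → ℝ`; the norm on `Fin m → ℝ` is the sup norm. -/

/-- The observation in (zero-based) position `j`; the value `0` is used only when `j ≥ n`. -/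
def obs {n m : ℕ} (x : Fin n → Fin m → ℝ) (j : ℕ) : Fin m → ℝ :=
  if h : j < n then x ⟨j, h⟩ else 0

/-- The observation `X_{σ(j+1)}`: the one that the permutation `σ` puts in position `j`. -/
def draw {n m : ℕ} (x : Fin n → Fin m → ℝ) (σ : Equiv.Perm (Fin n)) (j : ℕ) : Fin m → ℝ :=
  obs (fun i => x (σ i)) j

/-- The sample mean. -/
def sampleMean {n m : ℕ} (x : Fin n → Fin m → ℝ) : Fin m → ℝ :=
  (n : ℝ)⁻¹ • ∑ i, x i

/-- The sample variance matrix `n⁻¹ ∑ᵢ (Xᵢ - X̄)(Xᵢ - X̄)'`. -/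
def sampleVar {n m : ℕ} (x : Fin n → Fin m → ℝ) : Matrix (Fin m) (Fin m) ℝ :=
  (n : ℝ)⁻¹ • ∑ i, Matrix.vecMulVec (x i - sampleMean x) (x i - sampleMean x)

/-- The U-type statistic of the `k`-th coordinate, centred at `μ`, from `R` permutations. -/
def uStat {n m R : ℕ} (x : Fin n → Fin m → ℝ) (k : Fin m) (μ : ℝ)
    (π : Fin R → Equiv.Perm (Fin n)) : ℝ :=
  1 / √((m : ℝ) * R) *
    ∑ r, (draw x (π r) 0 k - μ) * (sampleVar x k k)⁻¹ * (draw x (π r) 1 k - μ)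

/-- The correction term `λ̂ₖ`. -/
def lambdaHat {n m R : ℕ} (x : Fin n → Fin m → ℝ) (k : Fin m)
    (π : Fin R → Equiv.Perm (Fin n)) : ℝ :=
  sampleMean x k * (sampleVar x k k)⁻¹ * (1 / √((m : ℝ) * R)) *
      ∑ r, (draw x (π r) 0 k + draw x (π r) 1 k)
    - √((R : ℝ) / m) * (sampleVar x k k)⁻¹ * sampleMean x k ^ 2

/-- The test statistic `Qₙ(π)`. -/
def qStat {n m R : ℕ} (x : Fin n → Fin m → ℝ) (π : Fin R → Equiv.Perm (Fin n)) : ℝ :=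
  ⨆ k : Fin m, (uStat x k 0 π - if sampleMean x k < 0 then lambdaHat x k π else 0)

/-- The resampling statistic `Q̃ₙ(π)`. -/
def qTilde {n m R : ℕ} (x : Fin n → Fin m → ℝ) (π : Fin R → Equiv.Perm (Fin n)) : ℝ :=
  ⨆ k : Fin m, uStat x k (sampleMean x k) π

/-! ### The random permutations, the critical value and the test -/

instance permMeasurableSpace (n : ℕ) : MeasurableSpace (Equiv.Perm (Fin n)) := ⊤

instance permDiscrete (n : ℕ) : DiscreteMeasurableSpace (Equiv.Perm (Fin n)) :=
  ⟨fun _ => trivial⟩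

/-- The law of `R` i.i.d. uniform permutations of `n` indices. -/
def drawLaw (n R : ℕ) : Measure (Fin R → Equiv.Perm (Fin n)) :=
  Measure.pi fun _ => uniformOn Set.univ

/-- The `(1 - α)`-quantile of the law of `Q̃ₙ(π)` when the data are held fixed at `x`. -/
def critVal {n m : ℕ} (R : ℕ) (α : ℝ) (x : Fin n → Fin m → ℝ) : ℝ :=
  sInf {c : ℝ | 1 - α ≤ (drawLaw n R).real {π | qTilde x π ≤ c}}

/-- The test `φₙ = 1{Qₙ(π) > c_{1-α}}`. -/
def testFn {n m R : ℕ} (α : ℝ) (x : Fin n → Fin m → ℝ)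
    (π : Fin R → Equiv.Perm (Fin n)) : ℝ :=
  if critVal R α x < qStat x π then 1 else 0

/-! ### Data-generating processes

The data form a triangular array: the sample of size `n` is `X n 0, …, X n (n-1)`. A
data-generating process is a probability measure on the underlying space `Ω`. -/

variable {Ω : Type*} [MeasurableSpace Ω] {m : ℕ}

/-- The sample of size `n` at the outcome `ω`. -/
def sample (X : (n : ℕ) → Fin n → Ω → Fin m → ℝ) (n : ℕ) (ω : Ω) : Fin n → Fin m → ℝ :=
  fun i => X n i ω

/-- The rejection probability `E_P[φₙ]`; the permutations are independent of the data. -/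
def rejProb (X : (n : ℕ) → Fin n → Ω → Fin m → ℝ) (α : ℝ) (n R : ℕ)
    (P : ProbabilityMeasure Ω) : ℝ :=
  ∫ z : Ω × (Fin R → Equiv.Perm (Fin n)), testFn α (sample X n z.1) z.2
    ∂((P : Measure Ω).prod (drawLaw n R))

/-- `μ₀(P) = E_P[X₁]`, for the sample of size `n`. -/
def mean (X : (n : ℕ) → Fin n → Ω → Fin m → ℝ) (n : ℕ) (P : ProbabilityMeasure Ω) :
    Fin m → ℝ :=
  ∫ ω, obs (sample X n ω) 0 ∂(P : Measure Ω)

/-- Under `P`, every row of the array consists of identically distributed integrable vectors. -/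
def RowsIdentDistrib (X : (n : ℕ) → Fin n → Ω → Fin m → ℝ) (P : ProbabilityMeasure Ω) : Prop :=
  ∀ n, ∀ i j : Fin n, Integrable (X n i) (P : Measure Ω) ∧
    IdentDistrib (X n i) (X n j) (P : Measure Ω) (P : Measure Ω)

/-- `Yₙ = O_{Pₙ}(1)`. -/
def IsBoundedInProb {E : Type*} [Norm E] (P : ℕ → ProbabilityMeasure Ω) (Y : ℕ → Ω → E) :
    Prop :=
  ∀ ε > (0 : ℝ), ∃ M : ℝ, ∀ᶠ n in atTop, (P n : Measure Ω).real {ω | M < ‖Y n ω‖} ≤ ε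

/-- `‖M‖ = max_{i,j} |M i j|`. -/
def maxNorm (M : Matrix (Fin m) (Fin m) ℝ) : ℝ :=
  ⨆ i, ⨆ j, |M i j|

/-- `P₀` is a class of null data-generating processes: with constants `δ, L, U ∈ (0, ∞)` common to
the class, along every sequence in `P₀` the sample mean is `√n`-consistent, the sample variance is
consistent for variance matrices `S n` bounded by `U` with smallest eigenvalue above `L`, the
empirical moments of order `2 + δ` are bounded in probability, and the means are nonpositive. -/
def IsNullClass (X : (n : ℕ) → Fin n → Ω → Fin m → ℝ) (P₀ : Set (ProbabilityMeasure Ω)) : Prop :=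
  (∀ P ∈ P₀, RowsIdentDistrib X P) ∧
  ∃ δ L U : ℝ, 0 < δ ∧ 0 < L ∧ 0 < U ∧
    ∀ P : ℕ → ProbabilityMeasure Ω, (∀ n, P n ∈ P₀) →
      IsBoundedInProb P (fun n ω => (√(n : ℝ))⁻¹ • ∑ i, (X n i ω - mean X n (P n))) ∧
      (∃ S : ℕ → Matrix (Fin m) (Fin m) ℝ,
        (∀ n, maxNorm (S n) < U ∧ ∃ h : (S n).IsHermitian, ∀ k, L < h.eigenvalues k) ∧
        ∀ ε > (0 : ℝ), Tendsto
          (fun n => (P n : Measure Ω).real {ω | ε ≤ maxNorm (sampleVar (sample X n ω) - S n)})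
          atTop (𝓝 0)) ∧
      IsBoundedInProb P (fun n ω => (n : ℝ)⁻¹ * ∑ i, ‖X n i ω‖ ^ (2 + δ)) ∧
      (∀ n, mean X n (P n) ≤ 0)

end

end ResampledMI

namespace ResampledMI

/-! Expanding the product shows that subtracting `λ̂ₖ` from the statistic centred at `0` gives
exactly the statistic centred at the sample mean (`uStat_sub_lambdaHat`). Coordinates with a
negative sample mean therefore contribute the same term to `qStat` and `qTilde`. In the other
coordinates the null forces the sample mean into `[0, K/√n]`, and there `λ̂ₖ` is a mean-zero sum
with conditional variance `O(1/n)` plus a bias of order `√R/n`, both negligible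
(`measureReal_lambdaHat_gt_le`). So, for the same permutations, the two maxima are close with high
conditional probability.

The critical value is the quantile of `qTilde` itself, so no limit law is needed. It is enough that
`qTilde` puts little mass near any point (`abs_measureReal_critVal_lt_sub_le`), and a union bound
over coordinates reduces this to a single U-type statistic. With the data fixed, that statistic is a
normalised sum of `R` independent copies of one kernel. A variance bounded below and bounded moments
of order `2 + δ` force the kernel to take moderate values of both signs with probability bounded
below (`exists_kernel_spread`). Its characteristic function then has Gaussian decay near the origin,
and smoothing bounds the concentration by `C(ε + 1/(Rε²))` (`measureReal_pi_abs_sum_sub_le`).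

These bounds are uniform over regular data sets, and data are regular with probability close to one
along every sequence in the class. Choosing nearly worst members of the class turns convergence
along sequences into convergence of the supremum. -/

/-! ### Concentration functions and characteristic functions -/

/-- A smoothing inequality: the mass of a short interval is controlled by a Gaussian average of the
modulus of the characteristic function. -/
theorem measureReal_abs_sub_le_le_integral_norm_charFun (ν : Measure ℝ) [IsProbabilityMeasure ν]
    (c : ℝ) {ε : ℝ} (hε : 0 < ε) :
    ν.real {x | |x - c| ≤ ε} ≤ 2 * ∫ s, ‖charFun ν (s / ε)‖ ∂(gaussianReal 0 1) := by
  -- The Gaussian bump is its own characteristic function, so Fubini turns its `ν`-mean into a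
  -- Gaussian average of `charFun ν`.
  have hint : ∀ x : ℝ, Complex.exp (-(((x - c) / ε : ℝ) : ℂ) ^ 2 / 2)
      = ∫ s : ℝ, Complex.exp (s * ((x - c) / ε : ℝ) * Complex.I) ∂(gaussianReal 0 1) := by
    intro x
    have h := charFun_gaussianReal (μ := 0) (v := 1) ((x - c) / ε)
    rw [charFun_apply_real] at h
    simp only [Complex.ofReal_zero, mul_zero, zero_mul, NNReal.coe_one, Complex.ofReal_one, one_mul,
      zero_sub] at h
    rw [neg_div, ← h]
    congr 1 with s
    ring_nf
  have hswap : ∫ x : ℝ, Complex.exp (-(((x - c) / ε : ℝ) : ℂ) ^ 2 / 2) ∂ν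
      = ∫ s : ℝ, (∫ x : ℝ, Complex.exp (s * ((x - c) / ε : ℝ) * Complex.I) ∂ν)
          ∂(gaussianReal 0 1) := by
    simp_rw [hint]
    refine integral_integral_swap ?_
    refine Integrable.of_bound (C := 1) ?_ (ae_of_all _ fun p => ?_)
    · exact Continuous.aestronglyMeasurable (by fun_prop)
    · simp only [Function.uncurry]
      rw [← Complex.ofReal_mul, Complex.norm_exp_ofReal_mul_I]
  have hnorm : ∀ s : ℝ, ‖∫ x : ℝ, Complex.exp (s * ((x - c) / ε : ℝ) * Complex.I) ∂ν‖
      = ‖charFun ν (s / ε)‖ := by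
    intro s
    have : ∀ x : ℝ, Complex.exp (s * ((x - c) / ε : ℝ) * Complex.I)
        = Complex.exp ((-(s * c / ε) : ℝ) * Complex.I) *
          Complex.exp ((s / ε : ℝ) * x * Complex.I) := by
      intro x
      rw [← Complex.exp_add]
      congr 1
      push_cast
      ring
    simp_rw [this]
    rw [integral_const_mul, norm_mul, Complex.norm_exp_ofReal_mul_I, one_mul, charFun_apply_real]
  have hreal : ∫ x : ℝ, Complex.exp (-(((x - c) / ε : ℝ) : ℂ) ^ 2 / 2) ∂ν
      = ((∫ x : ℝ, Real.exp (-((x - c) / ε) ^ 2 / 2) ∂ν : ℝ) : ℂ) := by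
    rw [← integral_complex_ofReal]
    congr 1 with x
    push_cast
    rfl
  have hupper : ∫ x : ℝ, Real.exp (-((x - c) / ε) ^ 2 / 2) ∂ν
      ≤ ∫ s, ‖charFun ν (s / ε)‖ ∂(gaussianReal 0 1) := by
    calc ∫ x : ℝ, Real.exp (-((x - c) / ε) ^ 2 / 2) ∂ν
        ≤ ‖((∫ x : ℝ, Real.exp (-((x - c) / ε) ^ 2 / 2) ∂ν : ℝ) : ℂ)‖ := by
          rw [Complex.norm_real]
          exact le_abs_self _
      _ ≤ ∫ s, ‖∫ x : ℝ, Complex.exp (s * ((x - c) / ε : ℝ) * Complex.I) ∂ν‖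
            ∂(gaussianReal 0 1) := by
          rw [← hreal, hswap]
          exact norm_integral_le_integral_norm _
      _ = _ := by simp_rw [hnorm]
  have hmeas : MeasurableSet {x : ℝ | |x - c| ≤ ε} :=
    measurableSet_le (by fun_prop) (by fun_prop)
  have hexp : Integrable (fun x : ℝ => Real.exp (-((x - c) / ε) ^ 2 / 2)) ν := by
    refine Integrable.of_bound (C := 1) (Continuous.aestronglyMeasurable (by fun_prop))
      (ae_of_all _ fun x => ?_)
    rw [Real.norm_eq_abs, abs_of_pos (Real.exp_pos _), Real.exp_le_one_iff]
    have := sq_nonneg ((x - c) / ε)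
    linarith
  -- The factor `2` comes from `exp (-u²/2) ≥ 1 - u²/2 ≥ 1/2` for `|u| ≤ 1`.
  have hlower : ν.real {x | |x - c| ≤ ε} ≤ ∫ x : ℝ, 2 * Real.exp (-((x - c) / ε) ^ 2 / 2) ∂ν := by
    rw [← integral_indicator_one hmeas]
    refine integral_mono ((integrable_const (1 : ℝ)).indicator hmeas) (hexp.const_mul 2) fun x => ?_
    by_cases hx : x ∈ {x : ℝ | |x - c| ≤ ε}
    · rw [Set.indicator_of_mem hx]
      have h1 : ((x - c) / ε) ^ 2 ≤ 1 := by
        rw [sq_le_one_iff_abs_le_one, abs_div, abs_of_pos hε, div_le_one hε]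
        exact hx
      have h2 := Real.add_one_le_exp (-((x - c) / ε) ^ 2 / 2)
      simp only [Pi.one_apply]
      linarith
    · rw [Set.indicator_of_notMem hx]
      positivity
  rw [integral_const_mul] at hlower
  linarith

/-- The exact value is `1 / √(1 + 2β)`; the `1` under the root is dropped. -/
theorem integral_exp_neg_mul_sq_gaussianReal {β : ℝ} (hβ : 0 < β) :
    ∫ s, Real.exp (-β * s ^ 2) ∂(gaussianReal 0 1) ≤ 1 / √(2 * β) := by
  rw [integral_gaussianReal_eq_integral_smul one_ne_zero]
  have : ∀ s : ℝ, gaussianPDFReal 0 1 s • Real.exp (-β * s ^ 2)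
      = (√(2 * Real.pi))⁻¹ * Real.exp (-(β + 1 / 2) * s ^ 2) := by
    intro s
    simp only [gaussianPDFReal, NNReal.coe_one, mul_one, sub_zero, smul_eq_mul]
    rw [mul_assoc, ← Real.exp_add]
    congr 2
    ring
  simp_rw [this]
  rw [integral_const_mul, integral_gaussian, ← Real.sqrt_inv, ← Real.sqrt_mul (by positivity),
    ← Real.sqrt_one, ← Real.sqrt_div' 1 (by positivity), Real.sqrt_one]
  refine Real.sqrt_le_sqrt ?_
  have hpi := Real.pi_pos
  rw [inv_mul_eq_div, div_div, div_le_div_iff₀ (by positivity) (by positivity)]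
  nlinarith

theorem integral_sq_gaussianReal : ∫ s, s ^ 2 ∂(gaussianReal 0 1) = 1 := by
  have h := variance_fun_id_gaussianReal (μ := 0) (v := 1)
  rw [variance_of_integral_eq_zero (by fun_prop) (by simp)] at h
  simpa using h

/-- A variable that takes values of both signs, bounded away from zero and from infinity, with
probability at least `q` has a characteristic function with Gaussian decay near the origin. -/
theorem norm_charFun_map_le_exp {A : Type*} [MeasurableSpace A] (μ : Measure A)
    [IsProbabilityMeasure μ] {W : A → ℝ} (hW : Measurable W) {b B q : ℝ} (hb : 0 < b)
    (hq : 0 ≤ q) (hpos : q ≤ μ.real {a | b ≤ W a ∧ W a ≤ B})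
    (hneg : q ≤ μ.real {a | b ≤ -W a ∧ -W a ≤ B}) {t : ℝ} (ht : |t| * B ≤ 1) :
    ‖charFun (μ.map W) t‖ ≤ Real.exp (-(q ^ 2 * b ^ 2 / 4 * t ^ 2)) := by
  set κ : ℝ := q ^ 2 * b ^ 2 / 2 with hκ
  have hcosm : Measurable fun a => Real.cos (t * W a) := by fun_prop
  have hsinm : Measurable fun a => Real.sin (t * W a) := by fun_prop
  have hchar : charFun (μ.map W) t
      = (∫ a, Real.cos (t * W a) ∂μ : ℝ) + (∫ a, Real.sin (t * W a) ∂μ : ℝ) * Complex.I := by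
    rw [charFun_apply_real, integral_map hW.aemeasurable
      (Continuous.aestronglyMeasurable (by fun_prop))]
    rw [← integral_complex_ofReal, ← integral_complex_ofReal, ← integral_mul_const, ← integral_add]
    · congr 1 with a
      rw [← Complex.ofReal_mul, Complex.exp_mul_I, Complex.ofReal_cos, Complex.ofReal_sin]
    · refine (Integrable.of_bound (C := 1) hcosm.aestronglyMeasurable (ae_of_all _ fun a => ?_)).ofReal
      exact Real.abs_cos_le_one _
    · refine Integrable.mul_const (Integrable.ofReal ?_) _
      refine Integrable.of_bound (C := 1) hsinm.aestronglyMeasurable (ae_of_all _ fun a => ?_)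
      exact Real.abs_sin_le_one _
  have hcosi : Integrable (fun p : A × A => Real.cos (t * (W p.1 - W p.2))) (μ.prod μ) := by
    refine Integrable.of_bound (C := 1) (Measurable.aestronglyMeasurable (by fun_prop))
      (ae_of_all _ fun a => Real.abs_cos_le_one _)
  -- Symmetrisation: the squared modulus is the characteristic function of `W - W'` for an
  -- independent copy `W'`, so `W` need not be centred.
  have hsq : ‖charFun (μ.map W) t‖ ^ 2 = ∫ p : A × A, Real.cos (t * (W p.1 - W p.2)) ∂(μ.prod μ) := by
    rw [hchar, ← Complex.normSq_eq_norm_sq, Complex.normSq_add_mul_I, sq, sq,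
      ← integral_prod_mul, ← integral_prod_mul, ← integral_add]
    · congr 1 with p
      rw [mul_sub, Real.cos_sub]
    · refine Integrable.of_bound (C := 1) (Measurable.aestronglyMeasurable (by fun_prop))
        (ae_of_all _ fun a => ?_)
      rw [norm_mul]
      exact mul_le_one₀ (Real.abs_cos_le_one _) (norm_nonneg _) (Real.abs_cos_le_one _)
    · refine Integrable.of_bound (C := 1) (Measurable.aestronglyMeasurable (by fun_prop))
        (ae_of_all _ fun a => ?_)
      rw [norm_mul]
      exact mul_le_one₀ (Real.abs_sin_le_one _) (norm_nonneg _) (Real.abs_sin_le_one _)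
  set E₁ : Set A := {a | b ≤ W a ∧ W a ≤ B} with hE₁
  set E₂ : Set A := {a | b ≤ -W a ∧ -W a ≤ B} with hE₂
  have hE₁m : MeasurableSet E₁ :=
    (measurableSet_le measurable_const hW).inter (measurableSet_le hW measurable_const)
  have hE₂m : MeasurableSet E₂ :=
    (measurableSet_le measurable_const hW.neg).inter (measurableSet_le hW.neg measurable_const)
  -- On `E₁ ×ˢ E₂`, of mass at least `q²`, the difference lies in `[2b, 2B]`, so the angle is at
  -- most `2 < π` and the quadratic bound on the cosine applies. Elsewhere `cos ≤ 1` suffices.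
  have hpt : ∀ p : A × A, Real.cos (t * (W p.1 - W p.2))
      ≤ 1 - (E₁ ×ˢ E₂).indicator (fun _ => b ^ 2 / 2 * t ^ 2) p := by
    intro p
    by_cases hp : p ∈ E₁ ×ˢ E₂
    · rw [Set.indicator_of_mem hp]
      obtain ⟨⟨h1, h2⟩, ⟨h3, h4⟩⟩ := hp
      have hd0 : 2 * b ≤ W p.1 - W p.2 := by linarith
      have hd1 : W p.1 - W p.2 ≤ 2 * B := by linarith
      have habs : |t * (W p.1 - W p.2)| ≤ Real.pi := by
        rw [abs_mul, abs_of_pos (by linarith : 0 < W p.1 - W p.2)]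
        have := mul_le_mul_of_nonneg_left hd1 (abs_nonneg t)
        linarith [Real.pi_gt_three]
      have hcos := Real.cos_le_one_sub_mul_cos_sq habs
      have hpi : (1 : ℝ) / 8 ≤ 2 / Real.pi ^ 2 := by
        rw [div_le_div_iff₀ (by norm_num) (by positivity)]
        nlinarith [Real.pi_lt_four, Real.pi_pos]
      have hmul : 4 * b ^ 2 * t ^ 2 ≤ (t * (W p.1 - W p.2)) ^ 2 := by
        have : (2 * b) ^ 2 ≤ (W p.1 - W p.2) ^ 2 := by gcongr
        nlinarith [sq_nonneg t]
      have := mul_le_mul hpi hmul (by positivity) (by positivity)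
      linarith
    · rw [Set.indicator_of_notMem hp, sub_zero]
      exact Real.cos_le_one _
  have hind : Integrable ((E₁ ×ˢ E₂).indicator (fun _ : A × A => b ^ 2 / 2 * t ^ 2)) (μ.prod μ) :=
    (integrable_const _).indicator (hE₁m.prod hE₂m)
  have hle : ‖charFun (μ.map W) t‖ ^ 2 ≤ 1 - κ * t ^ 2 := by
    rw [hsq]
    refine (integral_mono hcosi ((integrable_const 1).sub hind) hpt).trans ?_
    rw [integral_sub' (integrable_const _) hind, integral_indicator (hE₁m.prod hE₂m)]
    simp only [integral_const, probReal_univ, smul_eq_mul, mul_one, measureReal_restrict_apply,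
      MeasurableSet.univ, Set.univ_inter, measureReal_prod_prod]
    have : q * q ≤ μ.real E₁ * μ.real E₂ := by gcongr
    have h2 := mul_le_mul_of_nonneg_right this (by positivity : 0 ≤ b ^ 2 / 2 * t ^ 2)
    rw [hκ]
    linarith
  have hexp : ‖charFun (μ.map W) t‖ ^ 2 ≤ (Real.exp (-(q ^ 2 * b ^ 2 / 4 * t ^ 2))) ^ 2 := by
    refine hle.trans ?_
    rw [← Real.exp_nat_mul]
    have := Real.add_one_le_exp (((2 : ℕ) : ℝ) * -(q ^ 2 * b ^ 2 / 4 * t ^ 2))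
    refine le_trans (le_of_eq ?_) this
    rw [hκ]
    push_cast
    ring
  exact le_of_sq_le_sq hexp (Real.exp_pos _).le

/-- Anticoncentration of a sum of independent copies of such a variable. -/
theorem measureReal_pi_abs_sum_sub_le {A : Type*} [MeasurableSpace A] (μ : Measure A)
    [IsProbabilityMeasure μ] {W : A → ℝ} (hW : Measurable W) {b B q : ℝ} (hb : 0 < b) (hB : 0 < B)
    (hq : 0 < q) (hpos : q ≤ μ.real {a | b ≤ W a ∧ W a ≤ B})
    (hneg : q ≤ μ.real {a | b ≤ -W a ∧ -W a ≤ B}) {R : ℕ} {h ε : ℝ} (hR : 0 < R) (hh : 0 < h)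
    (hε : 0 < ε) (c : ℝ) :
    (Measure.pi fun _ : Fin R => μ).real {π | |h * ∑ r, W (π r) - c| ≤ ε}
      ≤ 2 * (2 * ε / (q * b * h * √R) + (h * B / ε) ^ 2) := by
  set ρ := Measure.pi fun _ : Fin R => μ
  have hT : Measurable fun π : Fin R → A => h * ∑ r, W (π r) := by fun_prop
  have hprob : IsProbabilityMeasure (ρ.map fun π => h * ∑ r, W (π r)) :=
    Measure.isProbabilityMeasure_map hT.aemeasurable
  have hmain := measureReal_abs_sub_le_le_integral_norm_charFun
    (ρ.map fun π => h * ∑ r, W (π r)) c hε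
  rw [map_measureReal_apply hT (measurableSet_le (by fun_prop) (by fun_prop))] at hmain
  refine hmain.trans ?_
  have hchar : ∀ t : ℝ, charFun (ρ.map fun π => h * ∑ r, W (π r)) t
      = charFun (μ.map W) (t * h) ^ R := by
    intro t
    rw [charFun_apply_real, charFun_apply_real, integral_map hT.aemeasurable
      (Continuous.aestronglyMeasurable (by fun_prop)), integral_map hW.aemeasurable
      (Continuous.aestronglyMeasurable (by fun_prop))]
    have := integral_fintype_prod_eq_pow (ι := Fin R) (μ := μ)
      (fun a => Complex.exp ((t * h : ℝ) * W a * Complex.I))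
    rw [Fintype.card_fin] at this
    rw [← this]
    congr 1 with π
    rw [← Complex.exp_sum]
    congr 1
    push_cast
    rw [Finset.mul_sum, Finset.mul_sum, Finset.sum_mul]
    refine Finset.sum_congr rfl fun r _ => ?_
    ring
  set β : ℝ := R * (q ^ 2 * b ^ 2 / 4 * (h / ε) ^ 2) with hβ
  have hR' : (0 : ℝ) < R := by exact_mod_cast hR
  have hβpos : 0 < β := by positivity
  -- Gaussian decay is available only near the origin. Beyond it the modulus is at most `1`, hence
  -- at most `(hBs/ε)²`, which the Gaussian average turns into `(hB/ε)²`.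
  have hpt : ∀ s : ℝ, ‖charFun (ρ.map fun π => h * ∑ r, W (π r)) (s / ε)‖
      ≤ Real.exp (-β * s ^ 2) + (h * B / ε) ^ 2 * s ^ 2 := by
    intro s
    by_cases hs : |s / ε * h| * B ≤ 1
    · rw [hchar, norm_pow]
      have h1 := pow_le_pow_left₀ (norm_nonneg _)
        (norm_charFun_map_le_exp μ hW hb hq.le hpos hneg hs) R
      rw [← Real.exp_nat_mul] at h1
      have h2 : (R : ℝ) * -(q ^ 2 * b ^ 2 / 4 * (s / ε * h) ^ 2) = -β * s ^ 2 := by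
        rw [hβ]
        ring
      rw [h2] at h1
      have : 0 ≤ (h * B / ε) ^ 2 * s ^ 2 := by positivity
      linarith
    · have h1 : ‖charFun (ρ.map fun π => h * ∑ r, W (π r)) (s / ε)‖ ≤ 1 := norm_charFun_le_one _
      have h2 : 1 ≤ (|s / ε * h| * B) ^ 2 := one_le_pow₀ (not_le.mp hs).le
      rw [mul_pow, sq_abs] at h2
      have h3 : (h * B / ε) ^ 2 * s ^ 2 = (s / ε * h) ^ 2 * B ^ 2 := by ring
      have := Real.exp_pos (-β * s ^ 2)
      linarith
  have hi1 : Integrable (fun s : ℝ => Real.exp (-β * s ^ 2)) (gaussianReal 0 1) := by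
    refine Integrable.of_bound (C := 1) (Continuous.aestronglyMeasurable (by fun_prop))
      (ae_of_all _ fun x => ?_)
    rw [Real.norm_eq_abs, abs_of_pos (Real.exp_pos _), Real.exp_le_one_iff]
    nlinarith [sq_nonneg x]
  have hi2 : Integrable (fun s : ℝ => s ^ 2) (gaussianReal 0 1) :=
    (memLp_id_gaussianReal 2).integrable_sq
  have hbound : ∫ s, ‖charFun (ρ.map fun π => h * ∑ r, W (π r)) (s / ε)‖ ∂(gaussianReal 0 1)
      ≤ 1 / √(2 * β) + (h * B / ε) ^ 2 := by
    refine (integral_mono_of_nonneg (ae_of_all _ fun s => norm_nonneg _)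
      (hi1.add (hi2.const_mul _)) (ae_of_all _ hpt)).trans ?_
    simp only [Pi.add_apply]
    rw [integral_add hi1 (hi2.const_mul _), integral_const_mul, integral_sq_gaussianReal, mul_one]
    linarith [integral_exp_neg_mul_sq_gaussianReal hβpos]
  have hsqrt : 1 / √(2 * β) ≤ 2 * ε / (q * b * h * √R) := by
    have h1 : (q * b * h * √R) / (2 * ε) ≤ √(2 * β) := by
      refine Real.le_sqrt_of_sq_le ?_
      have : ((q * b * h * √R) / (2 * ε)) ^ 2 = β := by
        rw [hβ, div_pow, mul_pow _ (√R), Real.sq_sqrt hR'.le]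
        field_simp
        ring
      linarith
    have h2 : 2 * ε / (q * b * h * √R) = 1 / ((q * b * h * √R) / (2 * ε)) := by
      rw [one_div_div]
    rw [h2]
    exact one_div_le_one_div_of_le (by positivity) h1
  linarith

/-! ### Uniform permutations -/

instance isProbabilityMeasure_uniformOn_perm (n : ℕ) :
    IsProbabilityMeasure (uniformOn (Set.univ : Set (Equiv.Perm (Fin n)))) :=
  isProbabilityMeasure_uniformOn Set.finite_univ Set.univ_nonempty

instance isProbabilityMeasure_drawLaw (n R : ℕ) : IsProbabilityMeasure (drawLaw n R) := by
  unfold drawLaw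
  infer_instance

theorem integral_uniformOn_perm {n : ℕ} (f : Equiv.Perm (Fin n) → ℝ) :
    ∫ σ, f σ ∂(uniformOn Set.univ) = (Fintype.card (Equiv.Perm (Fin n)) : ℝ)⁻¹ * ∑ σ, f σ := by
  rw [integral_fintype .of_finite, Finset.mul_sum]
  refine Finset.sum_congr rfl fun σ _ => ?_
  rw [measureReal_def, uniformOn_univ, Measure.count_singleton, one_div, ENNReal.toReal_inv,
    ENNReal.toReal_natCast, smul_eq_mul]

/-- Composing with a transposition shows that the sum over permutations does not depend on the
position, so it may be averaged over all positions. -/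
theorem card_mul_sum_perm_apply {ι : Type*} [Fintype ι] [DecidableEq ι] (f : ι → ℝ) (i : ι) :
    (Fintype.card ι : ℝ) * ∑ σ : Equiv.Perm ι, f (σ i)
      = Fintype.card (Equiv.Perm ι) * ∑ j, f j := by
  have hconst : ∀ j, ∑ σ : Equiv.Perm ι, f (σ j) = ∑ σ : Equiv.Perm ι, f (σ i) := by
    intro j
    refine Fintype.sum_equiv (Equiv.mulRight (Equiv.swap i j)) _ _ fun σ => ?_
    simp
  calc (Fintype.card ι : ℝ) * ∑ σ : Equiv.Perm ι, f (σ i)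
      = ∑ j, ∑ σ : Equiv.Perm ι, f (σ j) := by
        simp [hconst]
    _ = ∑ σ : Equiv.Perm ι, ∑ j, f (σ j) := Finset.sum_comm
    _ = _ := by
        simp [Equiv.sum_comp]

/-- The same averaging over ordered pairs of distinct positions, with 2-transitivity of the
symmetric group in place of transpositions. -/
theorem card_offDiag_mul_sum_perm_apply {ι : Type*} [Fintype ι] [DecidableEq ι] (g : ι × ι → ℝ)
    {i j : ι} (hij : i ≠ j) :
    ((Finset.univ : Finset ι).offDiag.card : ℝ) * ∑ σ : Equiv.Perm ι, g (σ i, σ j)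
      = Fintype.card (Equiv.Perm ι) * ∑ p ∈ (Finset.univ : Finset ι).offDiag, g p := by
  have hconst : ∀ p ∈ (Finset.univ : Finset ι).offDiag,
      ∑ σ : Equiv.Perm ι, g (σ p.1, σ p.2) = ∑ σ : Equiv.Perm ι, g (σ i, σ j) := by
    intro p hp
    rw [Finset.mem_offDiag] at hp
    obtain ⟨τ, h1, h2⟩ := MulAction.is_two_pretransitive_iff.mp
      (Equiv.Perm.isMultiplyPretransitive ι 2) hij hp.2.2
    refine Fintype.sum_equiv (Equiv.mulRight τ) _ _ fun σ => ?_
    rw [Equiv.Perm.smul_def] at h1 h2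
    simp [h1, h2]
  calc ((Finset.univ : Finset ι).offDiag.card : ℝ) * ∑ σ : Equiv.Perm ι, g (σ i, σ j)
      = ∑ p ∈ (Finset.univ : Finset ι).offDiag, ∑ σ : Equiv.Perm ι, g (σ p.1, σ p.2) := by
        rw [Finset.sum_congr rfl hconst]
        simp
    _ = ∑ σ : Equiv.Perm ι, ∑ p ∈ (Finset.univ : Finset ι).offDiag, g (σ p.1, σ p.2) :=
        Finset.sum_comm
    _ = ∑ σ : Equiv.Perm ι, ∑ p ∈ (Finset.univ : Finset ι).offDiag, g p := by
        refine Finset.sum_congr rfl fun σ _ => ?_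
        refine Finset.sum_equiv (Equiv.prodCongr σ σ) (fun p => ?_) fun p _ => rfl
        simp
    _ = _ := by simp

theorem integral_perm_apply {n : ℕ} (hn : 0 < n) (f : Fin n → ℝ) (i : Fin n) :
    ∫ σ : Equiv.Perm (Fin n), f (σ i) ∂(uniformOn Set.univ) = (n : ℝ)⁻¹ * ∑ j, f j := by
  have h := card_mul_sum_perm_apply f i
  rw [Fintype.card_fin] at h
  have hn' : (n : ℝ) ≠ 0 := by positivity
  have hc : (Fintype.card (Equiv.Perm (Fin n)) : ℝ) ≠ 0 := by
    exact_mod_cast Fintype.card_ne_zero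
  rw [integral_uniformOn_perm]
  field_simp
  linarith

/-- The pair `(σ i, σ j)` is uniform on at most `n²` off-diagonal pairs, and each `a ∈ A` excludes
at most one `b ∈ B`. The sets may overlap or coincide. -/
theorem card_mul_card_sub_one_le_sq_mul_measureReal_perm {n : ℕ} (A B : Finset (Fin n))
    {i j : Fin n} (hij : i ≠ j) :
    (A.card : ℝ) * (B.card - 1)
      ≤ (n : ℝ) ^ 2 * (uniformOn Set.univ).real {σ : Equiv.Perm (Fin n) | σ i ∈ A ∧ σ j ∈ B} := by
  classical
  set S : Set (Equiv.Perm (Fin n)) := {σ | σ i ∈ A ∧ σ j ∈ B}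
  have hS : (uniformOn Set.univ).real S
      = (Fintype.card (Equiv.Perm (Fin n)) : ℝ)⁻¹ *
        ∑ σ : Equiv.Perm (Fin n), ((A ×ˢ B : Finset _) : Set (Fin n × Fin n)).indicator 1
          (σ i, σ j) := by
    rw [← integral_indicator_one (MeasurableSet.of_discrete (s := S)), integral_uniformOn_perm]
    congr 1
    refine Finset.sum_congr rfl fun σ _ => ?_
    simp [Set.indicator_apply, S]
  have hpair := card_offDiag_mul_sum_perm_apply
    (((A ×ˢ B : Finset _) : Set (Fin n × Fin n)).indicator 1) hij
  have hc : (Fintype.card (Equiv.Perm (Fin n)) : ℝ) ≠ 0 := by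
    exact_mod_cast Fintype.card_ne_zero
  have heq : ((Finset.univ : Finset (Fin n)).offDiag.card : ℝ) * (uniformOn Set.univ).real S
      = ∑ p ∈ (Finset.univ : Finset (Fin n)).offDiag,
        ((A ×ˢ B : Finset _) : Set (Fin n × Fin n)).indicator (1 : Fin n × Fin n → ℝ) p := by
    rw [hS]
    field_simp
    linarith
  have hcard : ((Finset.univ : Finset (Fin n)).offDiag.card : ℝ) ≤ (n : ℝ) ^ 2 := by
    have : (Finset.univ : Finset (Fin n)).offDiag.card ≤ n ^ 2 := by
      rw [Finset.offDiag_card, Finset.card_univ, Fintype.card_fin, sq]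
      exact Nat.sub_le _ _
    exact_mod_cast this
  refine le_trans ?_ (mul_le_mul_of_nonneg_right hcard measureReal_nonneg)
  rw [heq]
  have hsum : ∑ p ∈ (Finset.univ : Finset (Fin n)).offDiag,
        ((A ×ˢ B : Finset _) : Set (Fin n × Fin n)).indicator (1 : Fin n × Fin n → ℝ) p
      = ∑ a ∈ A, ((B.erase a).card : ℝ) := by
    have h1 : ∑ p ∈ (Finset.univ : Finset (Fin n)).offDiag,
        ((A ×ˢ B : Finset _) : Set (Fin n × Fin n)).indicator (1 : Fin n × Fin n → ℝ) p
        = ∑ p ∈ A ×ˢ B, if p.1 ≠ p.2 then (1 : ℝ) else 0 := by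
      rw [← Finset.sum_filter]
      simp only [Set.indicator_apply, Pi.one_apply]
      rw [← Finset.sum_filter]
      refine Finset.sum_congr ?_ fun _ _ => rfl
      ext p
      simp only [Finset.mem_filter, Finset.mem_offDiag, Finset.mem_coe, Finset.mem_univ, true_and]
      tauto
    rw [h1, Finset.sum_product]
    refine Finset.sum_congr rfl fun a _ => ?_
    rw [← Finset.sum_filter, Finset.sum_const, nsmul_eq_mul, mul_one]
    congr 2
    ext b
    simp only [Finset.mem_filter, Finset.mem_erase]
    tauto
  rw [hsum, ← nsmul_eq_mul]
  refine Finset.card_nsmul_le_sum _ _ _ fun a _ => ?_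
  have := Finset.pred_card_le_card_erase (s := B) (a := a)
  have h2 : B.card ≤ (B.erase a).card + 1 := by omega
  have h3 : (B.card : ℝ) ≤ (B.erase a).card + 1 := by exact_mod_cast h2
  linarith

/-! ### Spread of centred data -/

/-- Data with mean absolute value at least `2 * q`, mean zero and bounded second moment have a
positive fraction of moderately large positive values. -/
theorem card_moderate_ge {n : ℕ} (a : Fin n → ℝ) (hsum : ∑ i, a i = 0) {V q : ℝ} (hV : 0 < V)
    (hq : 0 < q) (hsq : ∑ i, a i ^ 2 ≤ n * V) (habs : n * (2 * q) ≤ ∑ i, |a i|) :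
    n * (q ^ 2 / (8 * V)) ≤
      ((Finset.univ.filter fun i => q / 4 ≤ a i ∧ a i ≤ 4 * V / q).card : ℝ) := by
  set S := Finset.univ.filter fun i => q / 4 ≤ a i ∧ a i ≤ 4 * V / q
  -- Since the data sum to zero, the positive parts average at least `q`. Values below `q/4` and
  -- values above `4V/q` (through the second moment) account for at most `q/4` each; the remaining
  -- `q/2` comes from moderate values, each at most `4V/q`.
  have hpt : ∀ i, (|a i| + a i) / 2 ≤ q / 4 + q / (4 * V) * a i ^ 2
      + 4 * V / q * (if q / 4 ≤ a i ∧ a i ≤ 4 * V / q then 1 else 0) := by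
    intro i
    have h0 : 0 ≤ q / (4 * V) * a i ^ 2 := by positivity
    have hV4 : 0 < 4 * V / q := by positivity
    rcases le_or_gt (a i) 0 with h | h
    · rw [abs_of_nonpos h]
      split_ifs <;> linarith
    · rw [abs_of_pos h]
      split_ifs with hc
      · linarith [hc.2]
      · rw [not_and_or, not_le, not_le] at hc
        rcases hc with hc | hc
        · linarith
        · have : a i ≤ q / (4 * V) * a i ^ 2 := by
            rw [div_lt_iff₀ hq] at hc
            rw [div_mul_eq_mul_div, le_div_iff₀ (by positivity)]
            nlinarith
          linarith
  have hs := Finset.sum_le_sum fun i (_ : i ∈ Finset.univ) => hpt i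
  rw [← Finset.sum_div, Finset.sum_add_distrib, hsum, Finset.sum_add_distrib,
    Finset.sum_add_distrib, ← Finset.mul_sum, ← Finset.mul_sum, Finset.sum_boole] at hs
  simp only [Finset.sum_const, Finset.card_univ, Fintype.card_fin, nsmul_eq_mul] at hs
  have h2 : q / (4 * V) * ∑ i, a i ^ 2 ≤ n * (q / 4) := by
    refine (mul_le_mul_of_nonneg_left hsq (by positivity)).trans (le_of_eq ?_)
    field_simp
  have h3 : n * (q / 2) ≤ 4 * V / q * (S.card : ℝ) := by linarith
  rw [div_mul_eq_mul_div, le_div_iff₀ hq] at h3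
  rw [← mul_div_assoc, div_le_iff₀ (by positivity)]
  linarith

/-- Interpolation: a lower bound on the second moment and an upper bound on a higher moment bound
the first absolute moment from below. -/
theorem exists_sum_abs_ge {δ v K : ℝ} (hδ : 0 < δ) (hv : 0 < v) :
    ∃ q > 0, ∀ (n : ℕ) (a : Fin n → ℝ), n * v ≤ ∑ i, a i ^ 2 →
      ∑ i, |a i| ^ (2 + δ) ≤ n * K → n * (2 * q) ≤ ∑ i, |a i| := by
  -- Truncation level: values above `B` carry at most half of the second moment.
  obtain ⟨B, hB, hBK⟩ : ∃ B : ℝ, 0 < B ∧ B ^ (-δ) * K ≤ v / 2 := by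
    have := (tendsto_rpow_neg_atTop hδ).mul_const K
    rw [zero_mul] at this
    exact ((eventually_gt_atTop 0).and (this.eventually_le_const (by positivity))).exists
  refine ⟨v / (4 * B), by positivity, fun n a h2 hK' => ?_⟩
  have hpt : ∀ i, a i ^ 2 ≤ B * |a i| + B ^ (-δ) * |a i| ^ (2 + δ) := by
    intro i
    rw [← sq_abs]
    have hx := abs_nonneg (a i)
    rcases le_or_gt (|a i|) B with h | h
    · have : 0 ≤ B ^ (-δ) * |a i| ^ (2 + δ) := by positivity
      nlinarith
    · have hx' : 0 < |a i| := hB.trans h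
      rw [Real.rpow_add hx', Real.rpow_two]
      have h1 : B ^ δ ≤ |a i| ^ δ := Real.rpow_le_rpow hB.le h.le hδ.le
      have h2 : 1 ≤ B ^ (-δ) * |a i| ^ δ := by
        rw [Real.rpow_neg hB.le, inv_mul_eq_div, le_div_iff₀ (by positivity)]
        linarith
      have h3 := mul_le_mul_of_nonneg_left h2 (sq_nonneg |a i|)
      have : 0 ≤ B * |a i| := by positivity
      nlinarith
  have hs := Finset.sum_le_sum fun i (_ : i ∈ Finset.univ) => hpt i
  rw [Finset.sum_add_distrib, ← Finset.mul_sum, ← Finset.mul_sum] at hs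
  have h3 := mul_le_mul_of_nonneg_left hK' (Real.rpow_nonneg hB.le (-δ))
  have hn : (0 : ℝ) ≤ n := Nat.cast_nonneg n
  have h4 := mul_le_mul_of_nonneg_left hBK hn
  have h5 : n * (v / 2) ≤ B * ∑ i, |a i| := by linarith
  have : n * (2 * (v / (4 * B))) = n * (v / 2) / B := by
    field_simp
    ring
  rw [this, div_le_iff₀ hB]
  linarith

/-- Centring increases the empirical moments by at most a bounded amount. -/
theorem sum_abs_sub_mean_rpow_le {p M : ℝ} (hp : 1 ≤ p) {n : ℕ} (hn : 0 < n) (y : Fin n → ℝ)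
    (hy : ∑ i, |y i| ^ p ≤ n * M) :
    ∑ i, |y i - (n : ℝ)⁻¹ * ∑ j, y j| ^ p ≤ n * (2 ^ p * (M + (1 + M) ^ p)) := by
  have hn' : (0 : ℝ) < n := by exact_mod_cast hn
  have hM : 0 ≤ M := by
    have : 0 ≤ ∑ i, |y i| ^ p := Finset.sum_nonneg fun i _ => by positivity
    exact nonneg_of_mul_nonneg_right (this.trans hy) hn'
  set c := (n : ℝ)⁻¹ * ∑ j, y j
  have hc : |c| ≤ 1 + M := by
    -- This bounds the mean by `1 + M`, so centring shifts the data by a bounded amount.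
    have hpt : ∀ i, |y i| ≤ 1 + |y i| ^ p := by
      intro i
      rcases le_or_gt (|y i|) 1 with h | h
      · have : 0 ≤ |y i| ^ p := by positivity
        linarith
      · have := Real.rpow_le_rpow_of_exponent_le h.le hp
        rw [Real.rpow_one] at this
        linarith
    have hs := Finset.sum_le_sum fun i (_ : i ∈ Finset.univ) => hpt i
    rw [Finset.sum_add_distrib] at hs
    simp only [Finset.sum_const, Finset.card_univ, Fintype.card_fin, nsmul_eq_mul, mul_one] at hs
    rw [abs_mul, abs_of_pos (inv_pos.mpr hn'), inv_mul_le_iff₀ hn']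
    have := Finset.abs_sum_le_sum_abs y Finset.univ
    linarith
  have hpt : ∀ i, |y i - c| ^ p ≤ 2 ^ p * (|y i| ^ p + (1 + M) ^ p) := by
    intro i
    have h1 : |y i - c| ≤ 2 * max |y i| (1 + M) := by
      have := abs_sub (y i) c
      have := le_max_left |y i| (1 + M)
      have := le_max_right |y i| (1 + M)
      linarith
    have hmax : 0 ≤ max |y i| (1 + M) := le_max_of_le_left (abs_nonneg _)
    refine (Real.rpow_le_rpow (abs_nonneg _) h1 (by linarith)).trans ?_
    rw [Real.mul_rpow (by norm_num) hmax]
    gcongr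
    have h3 : 0 ≤ |y i| ^ p := by positivity
    have h4 : 0 ≤ (1 + M) ^ p := by positivity
    rcases max_choice |y i| (1 + M) with h | h <;> rw [h] <;> linarith
  refine (Finset.sum_le_sum fun i _ => hpt i).trans ?_
  rw [← Finset.mul_sum, Finset.sum_add_distrib]
  simp only [Finset.sum_const, Finset.card_univ, Fintype.card_fin, nsmul_eq_mul]
  have : (0 : ℝ) < 2 ^ p := by positivity
  nlinarith

/-! ### The statistics of a fixed data set -/

theorem sampleMean_apply {n m : ℕ} (x : Fin n → Fin m → ℝ) (k : Fin m) :
    sampleMean x k = (n : ℝ)⁻¹ * ∑ i, x i k := by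
  simp [sampleMean]

theorem sampleVar_diag {n m : ℕ} (x : Fin n → Fin m → ℝ) (k : Fin m) :
    sampleVar x k k = (n : ℝ)⁻¹ * ∑ i, (x i k - sampleMean x k) ^ 2 := by
  simp [sampleVar, Matrix.sum_apply, Matrix.vecMulVec_apply, sq]

theorem draw_of_lt {n m : ℕ} (x : Fin n → Fin m → ℝ) (σ : Equiv.Perm (Fin n)) {j : ℕ}
    (hj : j < n) : draw x σ j = x (σ ⟨j, hj⟩) := by
  simp [draw, obs, hj]

theorem sum_sub_sampleMean {n m : ℕ} (hn : 0 < n) (x : Fin n → Fin m → ℝ) (k : Fin m) :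
    ∑ i, (x i k - sampleMean x k) = 0 := by
  have : (n : ℝ) ≠ 0 := by positivity
  rw [Finset.sum_sub_distrib, sampleMean_apply]
  simp only [Finset.sum_const, Finset.card_univ, Fintype.card_fin, nsmul_eq_mul]
  field_simp
  simp

/-- Centring at the sample mean amounts to subtracting the correction term. -/
theorem uStat_sub_lambdaHat {n m R : ℕ} (x : Fin n → Fin m → ℝ) (k : Fin m)
    (π : Fin R → Equiv.Perm (Fin n)) :
    uStat x k 0 π - lambdaHat x k π = uStat x k (sampleMean x k) π := by
  have hsqrt : √((R : ℝ) / m) = 1 / √((m : ℝ) * R) * R := by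
    rcases Nat.eq_zero_or_pos R with hR | hR
    · simp [hR]
    have hR' : (0 : ℝ) < R := by exact_mod_cast hR
    rw [Real.sqrt_div hR'.le, Real.sqrt_mul (Nat.cast_nonneg m), one_div_mul_eq_div]
    rw [div_mul_eq_div_div_swap, Real.div_sqrt]
  have hsum : ∀ μ : ℝ, ∑ r, (draw x (π r) 0 k - μ) * (sampleVar x k k)⁻¹ * (draw x (π r) 1 k - μ)
      = (sampleVar x k k)⁻¹ * ((∑ r, draw x (π r) 0 k * draw x (π r) 1 k)
        - μ * (∑ r, (draw x (π r) 0 k + draw x (π r) 1 k)) + R * μ ^ 2) := by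
    intro μ
    have : (R : ℝ) * μ ^ 2 = ∑ r : Fin R, μ ^ 2 := by simp
    rw [this, Finset.mul_sum, ← Finset.sum_sub_distrib, ← Finset.sum_add_distrib, Finset.mul_sum]
    refine Finset.sum_congr rfl fun r _ => ?_
    ring
  simp only [uStat, lambdaHat, hsum, hsqrt]
  ring

/-- `λ̂ₖ` as a centred sum plus a bias. -/
theorem lambdaHat_eq {n m R : ℕ} (x : Fin n → Fin m → ℝ) (k : Fin m)
    (π : Fin R → Equiv.Perm (Fin n)) (hR : 0 < R) :
    lambdaHat x k π
      = sampleMean x k * (sampleVar x k k)⁻¹ * (1 / √((m : ℝ) * R)) *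
          ∑ r, ((draw x (π r) 0 k - sampleMean x k) + (draw x (π r) 1 k - sampleMean x k))
        + √((R : ℝ) / m) * (sampleVar x k k)⁻¹ * sampleMean x k ^ 2 := by
  have hR' : (0 : ℝ) < R := by exact_mod_cast hR
  have hsqrt : √((R : ℝ) / m) = 1 / √((m : ℝ) * R) * R := by
    rw [Real.sqrt_div hR'.le, Real.sqrt_mul (Nat.cast_nonneg m), one_div_mul_eq_div]
    rw [div_mul_eq_div_div_swap, Real.div_sqrt]
  have hsum : ∑ r, ((draw x (π r) 0 k - sampleMean x k) + (draw x (π r) 1 k - sampleMean x k))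
      = ∑ r, (draw x (π r) 0 k + draw x (π r) 1 k) - 2 * (R * sampleMean x k) := by
    have : 2 * ((R : ℝ) * sampleMean x k) = ∑ r : Fin R, 2 * sampleMean x k := by
      simp
      ring
    rw [this, ← Finset.sum_sub_distrib]
    refine Finset.sum_congr rfl fun r _ => ?_
    ring
  rw [lambdaHat, hsum, hsqrt]
  ring

/-- The kernel of the centred U-type statistic takes moderate values of both signs with probability
bounded away from zero. -/
theorem exists_kernel_spread {m : ℕ} {δ L V M : ℝ} (hδ : 0 < δ) (hL : 0 < L) (hV : 0 < V) :
    ∃ b > 0, ∃ B > 0, ∃ q > 0, ∃ N : ℕ, ∀ n ≥ N, ∀ (x : Fin n → Fin m → ℝ) (k : Fin m),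
      L ≤ sampleVar x k k → sampleVar x k k ≤ V → (n : ℝ)⁻¹ * ∑ i, ‖x i‖ ^ (2 + δ) ≤ M →
      q ≤ (uniformOn Set.univ).real {σ : Equiv.Perm (Fin n) |
        b ≤ (draw x σ 0 k - sampleMean x k) * (sampleVar x k k)⁻¹ *
          (draw x σ 1 k - sampleMean x k) ∧
        (draw x σ 0 k - sampleMean x k) * (sampleVar x k k)⁻¹ *
          (draw x σ 1 k - sampleMean x k) ≤ B} ∧
      q ≤ (uniformOn Set.univ).real {σ : Equiv.Perm (Fin n) |
        b ≤ -((draw x σ 0 k - sampleMean x k) * (sampleVar x k k)⁻¹ *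
          (draw x σ 1 k - sampleMean x k)) ∧
        -((draw x σ 0 k - sampleMean x k) * (sampleVar x k k)⁻¹ *
          (draw x σ 1 k - sampleMean x k)) ≤ B} := by
  obtain ⟨q₀, hq₀, habs⟩ :=
    exists_sum_abs_ge (K := 2 ^ (2 + δ) * (M + (1 + M) ^ (2 + δ))) hδ hL
  set p : ℝ := q₀ ^ 2 / (8 * V) with hp
  have hp0 : 0 < p := by positivity
  set l : ℝ := q₀ / 4
  set u : ℝ := 4 * V / q₀
  have hl : 0 < l := by positivity
  have hu : 0 < u := by positivity
  -- Two centred draws of modulus in `[l, u]` give a kernel of modulus in `[l²/V, u²/L]`, positive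
  -- for equal signs and negative for opposite ones. Each sign class holds a fraction at least `p`
  -- of the data, and `n ≥ 2/p` absorbs the index lost to drawing without replacement, whence `p *
  -- (p / 2)`.
  refine ⟨l * V⁻¹ * l, by positivity, u * L⁻¹ * u, by positivity, p * (p / 2), by positivity,
    max 2 ⌈2 / p⌉₊, fun n hn x k hvL hvV hM => ?_⟩
  have hn2 : 2 ≤ n := (le_max_left _ _).trans hn
  have hnp : 2 / p ≤ n := (Nat.le_ceil _).trans (by exact_mod_cast (le_max_right _ _).trans hn)
  have hn0 : 0 < n := by omega
  have hn' : (0 : ℝ) < n := by exact_mod_cast hn0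
  have hv0 : 0 < sampleVar x k k := hL.trans_le hvL
  set a : Fin n → ℝ := fun i => x i k - sampleMean x k with ha
  set v := sampleVar x k k with hv
  have hsq : ∑ i, a i ^ 2 = n * v := by
    rw [hv, sampleVar_diag]
    field_simp
    rfl
  have hsum : ∑ i, a i = 0 := sum_sub_sampleMean hn0 x k
  have hmom : ∑ i, |a i| ^ (2 + δ) ≤ n * (2 ^ (2 + δ) * (M + (1 + M) ^ (2 + δ))) := by
    have hy : ∑ i, |x i k| ^ (2 + δ) ≤ n * M := by
      rw [inv_mul_le_iff₀ hn'] at hM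
      refine le_trans (Finset.sum_le_sum fun i _ => ?_) hM
      exact Real.rpow_le_rpow (abs_nonneg _) (norm_le_pi_norm (x i) k) (by linarith)
    have := sum_abs_sub_mean_rpow_le (by linarith : 1 ≤ 2 + δ) hn0 (fun i => x i k) hy
    rwa [← sampleMean_apply] at this
  have habs' := habs n a (by rw [hsq]; gcongr) hmom
  have hsqV : ∑ i, a i ^ 2 ≤ n * V := by
    rw [hsq]
    gcongr
  have hcp := card_moderate_ge a hsum hV hq₀ hsqV habs'
  have hcn := card_moderate_ge (fun i => -a i) (by simp [hsum]) hV hq₀ (by simpa using hsqV)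
    (by simpa using habs')
  set S₁ := Finset.univ.filter fun i => l ≤ a i ∧ a i ≤ u
  set S₂ := Finset.univ.filter fun i => l ≤ -a i ∧ -a i ≤ u
  set i₀ : Fin n := ⟨0, by omega⟩
  set i₁ : Fin n := ⟨1, by omega⟩
  have hi : i₀ ≠ i₁ := by
    simp [i₀, i₁]
  have hprob : ∀ A B : Finset (Fin n), n * p ≤ A.card → n * p ≤ B.card →
      p * (p / 2) ≤ (uniformOn Set.univ).real {σ : Equiv.Perm (Fin n) | σ i₀ ∈ A ∧ σ i₁ ∈ B} := by
    intro A B hA hB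
    have h := card_mul_card_sub_one_le_sq_mul_measureReal_perm A B hi
    rw [div_le_iff₀ hp0] at hnp
    have h1 : n * (p / 2) ≤ B.card - 1 := by linarith
    have h2 : (n * p) * (n * (p / 2)) ≤ A.card * (B.card - 1 : ℝ) := by gcongr
    have h3 : (n : ℝ) ^ 2 * (p * (p / 2)) ≤ (n : ℝ) ^ 2 *
        (uniformOn Set.univ).real {σ : Equiv.Perm (Fin n) | σ i₀ ∈ A ∧ σ i₁ ∈ B} := by
      linarith
    exact le_of_mul_le_mul_left h3 (by positivity)
  have hinv1 : V⁻¹ ≤ v⁻¹ := inv_anti₀ hv0 hvV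
  have hinv2 : v⁻¹ ≤ L⁻¹ := inv_anti₀ hL hvL
  have hVi : 0 < V⁻¹ := by positivity
  have hvi : 0 < v⁻¹ := by positivity
  have hdraw : ∀ σ : Equiv.Perm (Fin n), draw x σ 0 k - sampleMean x k = a (σ i₀) ∧
      draw x σ 1 k - sampleMean x k = a (σ i₁) := by
    intro σ
    rw [draw_of_lt x σ (by omega : 0 < n), draw_of_lt x σ (by omega : 1 < n)]
    exact ⟨rfl, rfl⟩
  have hmul : ∀ s t : ℝ, l ≤ s → s ≤ u → l ≤ t → t ≤ u →
      l * V⁻¹ * l ≤ s * v⁻¹ * t ∧ s * v⁻¹ * t ≤ u * L⁻¹ * u := by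
    intro s t h1 h2 h3 h4
    have hs : 0 < s := hl.trans_le h1
    have ht : 0 < t := hl.trans_le h3
    constructor <;> gcongr
  constructor
  · refine (hprob S₁ S₁ hcp hcp).trans (measureReal_mono fun σ hσ => ?_)
    simp only [S₁, Set.mem_ofPred_eq, Finset.mem_filter, Finset.mem_univ, true_and] at hσ
    simp only [Set.mem_ofPred_eq, (hdraw σ).1, (hdraw σ).2]
    exact hmul _ _ hσ.1.1 hσ.1.2 hσ.2.1 hσ.2.2
  · refine (hprob S₁ S₂ hcp hcn).trans (measureReal_mono fun σ hσ => ?_)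
    simp only [S₁, S₂, Set.mem_ofPred_eq, Finset.mem_filter, Finset.mem_univ, true_and] at hσ
    simp only [Set.mem_ofPred_eq, (hdraw σ).1, (hdraw σ).2]
    rw [← mul_neg]
    exact hmul _ _ hσ.1.1 hσ.1.2 hσ.2.1 hσ.2.2

/-- Anticoncentration of the centred U-type statistic, uniformly over regular data sets. -/
theorem exists_uStat_anticoncentration {m : ℕ} (hm : 0 < m) {δ L V M : ℝ} (hδ : 0 < δ) (hL : 0 < L)
    (hV : 0 < V) :
    ∃ C > 0, ∃ N : ℕ, ∀ n ≥ N, ∀ R > 0, ∀ (x : Fin n → Fin m → ℝ) (k : Fin m),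
      L ≤ sampleVar x k k → sampleVar x k k ≤ V → (n : ℝ)⁻¹ * ∑ i, ‖x i‖ ^ (2 + δ) ≤ M →
      ∀ ε > 0, ∀ c : ℝ, (drawLaw n R).real {π | |uStat x k (sampleMean x k) π - c| ≤ ε}
        ≤ C * (ε + 1 / (R * ε ^ 2)) := by
  obtain ⟨b, hb, B, hB, q, hq, N, hN⟩ := exists_kernel_spread (m := m) (M := M) hδ hL hV
  refine ⟨4 * √m / (q * b) + 2 * B ^ 2, by positivity, N, fun n hn R hR x k h1 h2 h3 ε hε c => ?_⟩
  obtain ⟨hpos, hneg⟩ := hN n hn x k h1 h2 h3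
  have hR' : (0 : ℝ) < R := by exact_mod_cast hR
  have hm' : (1 : ℝ) ≤ m := by exact_mod_cast hm
  have h := measureReal_pi_abs_sum_sub_le (uniformOn Set.univ) (W := fun σ : Equiv.Perm (Fin n) =>
    (draw x σ 0 k - sampleMean x k) * (sampleVar x k k)⁻¹ * (draw x σ 1 k - sampleMean x k))
    .of_discrete hb hB hq hpos hneg (h := 1 / √((m : ℝ) * R)) hR (by positivity) hε c
  refine h.trans ?_
  have e1 : 2 * ε / (q * b * (1 / √((m : ℝ) * R)) * √R) = 2 * √m / (q * b) * ε := by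
    rw [Real.sqrt_mul (by positivity)]
    field_simp
  have e2 : (1 / √((m : ℝ) * R) * B / ε) ^ 2 = B ^ 2 * (1 / (m * (R * ε ^ 2))) := by
    rw [div_pow, mul_pow, div_pow, Real.sq_sqrt (by positivity)]
    field_simp
  have e3 : 1 / (m * (R * ε ^ 2)) ≤ 1 / (R * ε ^ 2) := by
    refine one_div_le_one_div_of_le (by positivity) ?_
    exact le_mul_of_one_le_left (by positivity) hm'
  rw [e1, e2]
  have e4 : 0 ≤ 4 * √m / (q * b) * (1 / (R * ε ^ 2)) := by positivity
  have e5 : 0 ≤ 2 * B ^ 2 * ε := by positivity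
  have e6 := mul_le_mul_of_nonneg_left e3 (by positivity : 0 ≤ 2 * B ^ 2)
  have e7 : 4 * √m / (q * b) * ε = 2 * (2 * √m / (q * b) * ε) := by ring
  linarith

/-- Chebyshev's inequality for a sum over independent uniform permutations. -/
theorem measureReal_drawLaw_abs_sum_ge {n R : ℕ} (f : Equiv.Perm (Fin n) → ℝ)
    (hf : ∫ σ, f σ ∂(uniformOn Set.univ) = 0) (h : ℝ) {t : ℝ} (ht : 0 < t) :
    (drawLaw n R).real {π | t ≤ |h * ∑ r, f (π r)|}
      ≤ h ^ 2 * (R * ∫ σ, f σ ^ 2 ∂(uniformOn Set.univ)) / t ^ 2 := by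
  have hmem : MemLp f 2 (uniformOn Set.univ) := MemLp.of_discrete
  have hvar : Var[fun π : Fin R → Equiv.Perm (Fin n) => h * ∑ r, f (π r); drawLaw n R]
      = h ^ 2 * (R * ∫ σ, f σ ^ 2 ∂(uniformOn Set.univ)) := by
    rw [variance_const_mul]
    have := variance_sum_pi (ι := Fin R) (X := fun _ => f) (fun _ => hmem)
    have e : (∑ r : Fin R, fun π : Fin R → Equiv.Perm (Fin n) => f (π r))
        = fun π => ∑ r, f (π r) := by
      ext π
      simp
    rw [e] at this
    rw [drawLaw, this]
    simp [variance_of_integral_eq_zero (Measurable.of_discrete (f := f)).aemeasurable hf]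
  have hmean : ∫ π : Fin R → Equiv.Perm (Fin n), h * ∑ r, f (π r) ∂(drawLaw n R) = 0 := by
    rw [integral_const_mul, integral_finsetSum _ fun r _ => .of_finite]
    have : ∀ r : Fin R, ∫ π : Fin R → Equiv.Perm (Fin n), f (π r) ∂(drawLaw n R) = 0 := by
      intro r
      rw [drawLaw, integral_comp_eval (Measurable.of_discrete (f := f)).aestronglyMeasurable, hf]
    simp [this]
  have hch := meas_ge_le_variance_div_sq (μ := drawLaw n R)
    (X := fun π : Fin R → Equiv.Perm (Fin n) => h * ∑ r, f (π r)) MemLp.of_discrete ht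
  rw [hmean, hvar] at hch
  simp only [sub_zero] at hch
  have hnn : 0 ≤ h ^ 2 * (R * ∫ σ, f σ ^ 2 ∂(uniformOn Set.univ)) / t ^ 2 := by
    have : 0 ≤ ∫ σ, f σ ^ 2 ∂(uniformOn (Set.univ : Set (Equiv.Perm (Fin n)))) :=
      integral_nonneg fun σ => sq_nonneg _
    positivity
  exact ENNReal.toReal_le_of_le_ofReal hnn hch

/-- The correction term is negligible when the sample mean is of order `n ^ (-1/2)`. -/
theorem measureReal_lambdaHat_gt_le {n m R : ℕ} (hm : 0 < m) (hn : 2 ≤ n) (hR : 0 < R)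
    (x : Fin n → Fin m → ℝ) (k : Fin m) {L K ε : ℝ} (hL : 0 < L) (hε : 0 < ε)
    (hvL : L ≤ sampleVar x k k) (hx0 : 0 ≤ sampleMean x k) (hxK : sampleMean x k ≤ K / √n)
    (hbias : √R / n * (K ^ 2 / L) ≤ ε / 2) :
    (drawLaw n R).real {π | ε < |lambdaHat x k π|} ≤ 16 * K ^ 2 / (L * ε ^ 2) * (1 / n) := by
  have hn0 : 0 < n := by omega
  have hn' : (0 : ℝ) < n := by exact_mod_cast hn0
  have hR' : (0 : ℝ) < R := by exact_mod_cast hR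
  have hm' : (1 : ℝ) ≤ m := by exact_mod_cast hm
  have hv0 : 0 < sampleVar x k k := hL.trans_le hvL
  set v := sampleVar x k k with hv
  set c := sampleMean x k with hc
  have hinv : v⁻¹ ≤ L⁻¹ := inv_anti₀ hL hvL
  have hcsq : c ^ 2 ≤ K ^ 2 / n := by
    have : c ^ 2 ≤ (K / √n) ^ 2 := by gcongr
    rwa [div_pow, Real.sq_sqrt hn'.le] at this
  set f : Equiv.Perm (Fin n) → ℝ := fun σ => (draw x σ 0 k - c) + (draw x σ 1 k - c) with hf
  have hdraw : ∀ σ, f σ = (x (σ ⟨0, by omega⟩) k - c) + (x (σ ⟨1, by omega⟩) k - c) := by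
    intro σ
    rw [hf]
    simp only
    rw [draw_of_lt x σ (by omega : 0 < n), draw_of_lt x σ (by omega : 1 < n)]
  have hmean : ∫ σ, f σ ∂(uniformOn Set.univ) = 0 := by
    simp_rw [hdraw]
    rw [integral_add .of_finite .of_finite, integral_perm_apply hn0 (fun i => x i k - c),
      integral_perm_apply hn0 (fun i => x i k - c), sum_sub_sampleMean hn0]
    simp
  -- Using `(s + t)² ≤ 2s² + 2t²` makes the dependence between the two draws irrelevant.
  have hsecond : ∫ σ, f σ ^ 2 ∂(uniformOn Set.univ) ≤ 4 * v := by
    have hle : ∀ σ : Equiv.Perm (Fin n), f σ ^ 2 ≤ 2 * (x (σ ⟨0, by omega⟩) k - c) ^ 2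
        + 2 * (x (σ ⟨1, by omega⟩) k - c) ^ 2 := by
      intro σ
      rw [hdraw]
      nlinarith [sq_nonneg ((x (σ ⟨0, by omega⟩) k - c) - (x (σ ⟨1, by omega⟩) k - c))]
    refine (integral_mono .of_finite .of_finite hle).trans ?_
    rw [integral_add .of_finite .of_finite, integral_const_mul, integral_const_mul,
      integral_perm_apply hn0 (fun i => (x i k - c) ^ 2),
      integral_perm_apply hn0 (fun i => (x i k - c) ^ 2), ← sampleVar_diag]
    linarith
  have hbias' : √((R : ℝ) / m) * v⁻¹ * c ^ 2 ≤ ε / 2 := by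
    have h1 : √((R : ℝ) / m) ≤ √R := Real.sqrt_le_sqrt (div_le_self hR'.le hm')
    calc √((R : ℝ) / m) * v⁻¹ * c ^ 2 ≤ √R * L⁻¹ * (K ^ 2 / n) := by gcongr
      _ = √R / n * (K ^ 2 / L) := by ring
      _ ≤ ε / 2 := hbias
  -- The bias uses up `ε/2`, so Chebyshev is applied to the centred sum at level `ε/2`.
  have hch := measureReal_drawLaw_abs_sum_ge (R := R) f hmean (c * v⁻¹ * (1 / √((m : ℝ) * R)))
    (half_pos hε)
  refine le_trans (measureReal_mono fun π hπ => ?_) (hch.trans ?_)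
  · simp only [Set.mem_ofPred_eq] at hπ ⊢
    rw [lambdaHat_eq x k π hR] at hπ
    have h1 := abs_add_le (c * v⁻¹ * (1 / √((m : ℝ) * R)) * ∑ r, f (π r))
      (√((R : ℝ) / m) * v⁻¹ * c ^ 2)
    rw [abs_of_nonneg (by positivity : 0 ≤ √((R : ℝ) / m) * v⁻¹ * c ^ 2)] at h1
    linarith
  · have e1 : (c * v⁻¹ * (1 / √((m : ℝ) * R))) ^ 2 = c ^ 2 * (v⁻¹) ^ 2 * (1 / (m * R)) := by
      rw [mul_pow, mul_pow, div_pow, Real.sq_sqrt (by positivity), one_pow]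
    rw [e1]
    calc c ^ 2 * (v⁻¹) ^ 2 * (1 / (m * R)) * (R * ∫ σ, f σ ^ 2 ∂(uniformOn Set.univ)) / (ε / 2) ^ 2
        ≤ c ^ 2 * (v⁻¹) ^ 2 * (1 / (m * R)) * (R * (4 * v)) / (ε / 2) ^ 2 := by gcongr
      _ = c ^ 2 * v⁻¹ * (1 / m) * (16 / ε ^ 2) := by
          field_simp
          ring
      _ ≤ (K ^ 2 / n) * L⁻¹ * 1 * (16 / ε ^ 2) := by
          gcongr
          rw [div_le_one (by positivity)]
          exact hm'
      _ = 16 * K ^ 2 / (L * ε ^ 2) * (1 / n) := by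
          field_simp

/-! ### The conditional rejection probability -/

/-- With the boundedness below, this excludes the default value of the real infimum; both rest on
the finiteness of the permutation space. -/
theorem critVal_set_nonempty {n m R : ℕ} {α : ℝ} (hα : 0 < α) (x : Fin n → Fin m → ℝ) :
    {c : ℝ | 1 - α ≤ (drawLaw n R).real {π | qTilde x π ≤ c}}.Nonempty := by
  obtain ⟨c, hc⟩ := (Set.finite_range fun π : Fin R → Equiv.Perm (Fin n) => qTilde x π).bddAbove
  refine ⟨c, ?_⟩
  have : {π : Fin R → Equiv.Perm (Fin n) | qTilde x π ≤ c} = Set.univ :=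
    Set.eq_univ_of_forall fun π => hc ⟨π, rfl⟩
  rw [Set.mem_ofPred_eq, this, probReal_univ]
  linarith

theorem critVal_set_bddBelow {n m R : ℕ} {α : ℝ} (hα : α < 1) (x : Fin n → Fin m → ℝ) :
    BddBelow {c : ℝ | 1 - α ≤ (drawLaw n R).real {π | qTilde x π ≤ c}} := by
  obtain ⟨c, hc⟩ := (Set.finite_range fun π : Fin R → Equiv.Perm (Fin n) => qTilde x π).bddBelow
  refine ⟨c, fun d hd => ?_⟩
  by_contra! hdc
  have : {π : Fin R → Equiv.Perm (Fin n) | qTilde x π ≤ d} = ∅ := by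
    refine Set.eq_empty_of_forall_notMem fun π hπ => ?_
    have h1 := hc ⟨π, rfl⟩
    have h2 : qTilde x π ≤ d := hπ
    simp only at h1
    linarith
  rw [Set.mem_ofPred_eq, this, measureReal_empty] at hd
  linarith

/-- Rational thresholds make this a countable union, which gives measurability of the critical
value. -/
theorem critVal_lt_iff {n m R : ℕ} {α : ℝ} (hα : α ∈ Set.Ioo (0 : ℝ) 1) (x : Fin n → Fin m → ℝ)
    (c : ℝ) : critVal R α x < c ↔
      ∃ d : ℚ, (d : ℝ) < c ∧ 1 - α ≤ (drawLaw n R).real {π | qTilde x π ≤ d} := by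
  rw [critVal, csInf_lt_iff (critVal_set_bddBelow hα.2 x) (critVal_set_nonempty hα.1 x)]
  constructor
  · rintro ⟨d, hd, hdc⟩
    obtain ⟨e, hde, hec⟩ := exists_rat_btwn hdc
    refine ⟨e, hec, le_trans hd (measureReal_mono fun π hπ => ?_)⟩
    exact le_trans hπ hde.le
  · rintro ⟨d, hdc, hd⟩
    exact ⟨d, hd, hdc⟩

/-- The rejection probability differs from the nominal level by at most the mass of the
resampling law near its quantile and the probability that the two statistics are apart. -/
theorem abs_measureReal_critVal_lt_sub_le {n m R : ℕ} {α : ℝ} (hα : α ∈ Set.Ioo (0 : ℝ) 1)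
    (x : Fin n → Fin m → ℝ) {ε : ℝ} (hε : 0 < ε) :
    |(drawLaw n R).real {π | critVal R α x < qStat x π} - α|
      ≤ (drawLaw n R).real {π | |qTilde x π - critVal R α x| ≤ ε}
        + (drawLaw n R).real {π | ε < |qStat x π - qTilde x π|} := by
  set c := critVal R α x with hc
  set ρ := drawLaw n R
  have hcompl : ∀ d, ρ.real {π | d < qTilde x π} = 1 - ρ.real {π | qTilde x π ≤ d} := by
    intro d
    rw [← probReal_compl_eq_one_sub MeasurableSet.of_discrete]
    congr 1
    ext π
    simp
  -- The level `α` lies between the tails of `qTilde` beyond `c + ε` and `c - ε`. The margin `ε`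
  -- makes attainment of the infimum irrelevant.
  have hup : ρ.real {π | c + ε < qTilde x π} ≤ α := by
    obtain ⟨d, hd, hdF⟩ := (critVal_lt_iff (R := R) hα x (c + ε)).mp (by linarith)
    rw [hcompl]
    have : ρ.real {π | qTilde x π ≤ d} ≤ ρ.real {π | qTilde x π ≤ c + ε} :=
      measureReal_mono fun π hπ => le_trans hπ hd.le
    linarith
  have hlow : α ≤ ρ.real {π | c - ε < qTilde x π} := by
    rw [hcompl]
    by_contra! h
    have h1 : c ≤ c - ε := csInf_le (critVal_set_bddBelow hα.2 x)
      (show 1 - α ≤ ρ.real {π | qTilde x π ≤ c - ε} by linarith)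
    linarith
  have hgap : ρ.real {π | c - ε < qTilde x π}
      ≤ ρ.real {π | c + ε < qTilde x π} + ρ.real {π | |qTilde x π - c| ≤ ε} := by
    refine (measureReal_mono fun π hπ => ?_).trans (measureReal_union_le _ _)
    rcases lt_or_ge (c + ε) (qTilde x π) with h | h
    · exact Or.inl h
    · refine Or.inr ?_
      have h' : c - ε < qTilde x π := hπ
      show |qTilde x π - c| ≤ ε
      rw [abs_le]
      constructor <;> linarith
  have h1 : ρ.real {π | c < qStat x π}
      ≤ ρ.real {π | c - ε < qTilde x π} + ρ.real {π | ε < |qStat x π - qTilde x π|} := by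
    refine (measureReal_mono fun π hπ => ?_).trans (measureReal_union_le _ _)
    rcases lt_or_ge ε |qStat x π - qTilde x π| with h | h
    · exact Or.inr h
    · refine Or.inl ?_
      have h2 : c < qStat x π := hπ
      have h3 := (abs_le.mp h).2
      show c - ε < qTilde x π
      linarith
  have h2 : ρ.real {π | c + ε < qTilde x π}
      ≤ ρ.real {π | c < qStat x π} + ρ.real {π | ε < |qStat x π - qTilde x π|} := by
    refine (measureReal_mono fun π hπ => ?_).trans (measureReal_union_le _ _)
    rcases lt_or_ge ε |qStat x π - qTilde x π| with h | h
    · exact Or.inr h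
    · refine Or.inl ?_
      have h2 : c + ε < qTilde x π := hπ
      have h3 := (abs_le.mp h).1
      show c < qStat x π
      linarith
  rw [abs_le]
  constructor <;> linarith

theorem abs_ciSup_sub_ciSup_le {ι : Type*} [Finite ι] [Nonempty ι] {f g : ι → ℝ} {ε : ℝ}
    (h : ∀ i, |f i - g i| ≤ ε) : |(⨆ i, f i) - ⨆ i, g i| ≤ ε := by
  have hf := (Set.finite_range f).bddAbove
  have hg := (Set.finite_range g).bddAbove
  have h1 : (⨆ i, f i) ≤ (⨆ i, g i) + ε := ciSup_le fun i => by
    linarith [(abs_le.mp (h i)).2, le_ciSup hg i]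
  have h2 : (⨆ i, g i) ≤ (⨆ i, f i) + ε := ciSup_le fun i => by
    linarith [(abs_le.mp (h i)).1, le_ciSup hf i]
  rw [abs_le]
  constructor <;> linarith

/-- A finite maximum is attained, so some coordinate lies near `c`; the joint law of the coordinates
plays no role. -/
theorem measureReal_qTilde_le_sum {n m R : ℕ} (hm : 0 < m) (x : Fin n → Fin m → ℝ) (c ε : ℝ) :
    (drawLaw n R).real {π | |qTilde x π - c| ≤ ε}
      ≤ ∑ k, (drawLaw n R).real {π | |uStat x k (sampleMean x k) π - c| ≤ ε} := by
  have : Nonempty (Fin m) := ⟨⟨0, hm⟩⟩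
  refine (measureReal_mono fun π hπ => ?_).trans (measureReal_iUnion_fintype_le _)
  obtain ⟨k, hk⟩ := exists_eq_ciSup_of_finite (f := fun k => uStat x k (sampleMean x k) π)
  refine Set.mem_iUnion.mpr ⟨k, ?_⟩
  rw [Set.mem_ofPred_eq, qTilde, ← hk] at hπ
  exact hπ

/-- Maxima are 1-Lipschitz, and by `uStat_sub_lambdaHat` the terms differ by `λ̂ₖ` or not at all. -/
theorem measureReal_qStat_sub_qTilde_le_sum {n m R : ℕ} (hm : 0 < m) (x : Fin n → Fin m → ℝ)
    {ε : ℝ} (hε : 0 < ε) :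
    (drawLaw n R).real {π | ε < |qStat x π - qTilde x π|}
      ≤ ∑ k, (drawLaw n R).real {π | 0 ≤ sampleMean x k ∧ ε < |lambdaHat x k π|} := by
  have : Nonempty (Fin m) := ⟨⟨0, hm⟩⟩
  refine (measureReal_mono fun π hπ => ?_).trans (measureReal_iUnion_fintype_le _)
  by_contra hnot
  refine absurd (show ε < |qStat x π - qTilde x π| from hπ) (not_lt.mpr ?_)
  refine abs_ciSup_sub_ciSup_le fun k => ?_
  have hk : ¬(0 ≤ sampleMean x k ∧ ε < |lambdaHat x k π|) := fun h =>
    hnot (Set.mem_iUnion.mpr ⟨k, h⟩)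
  rw [← uStat_sub_lambdaHat]
  split_ifs with h0
  · simpa using hε.le
  · rw [not_lt] at h0
    rw [sub_zero, sub_sub_cancel]
    exact not_lt.mp fun h => hk ⟨h0, h⟩

/-- Uniformly over regular data sets, the conditional rejection probability tends to the nominal
level. -/
theorem eventually_abs_measureReal_critVal_lt_sub_le {m : ℕ} (hm : 0 < m) {α : ℝ}
    (hα : α ∈ Set.Ioo (0 : ℝ) 1) {R : ℕ → ℕ} (hR : Tendsto R atTop atTop)
    (hRn : Tendsto (fun n : ℕ => √(R n : ℝ) / n) atTop (𝓝 0)) {δ L V : ℝ} (hδ : 0 < δ)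
    (hL : 0 < L) (hV : 0 < V) (M K : ℝ) {η : ℝ} (hη : 0 < η) :
    ∀ᶠ n in atTop, ∀ x : Fin n → Fin m → ℝ,
      (∀ k, L ≤ sampleVar x k k) → (∀ k, sampleVar x k k ≤ V) →
      (n : ℝ)⁻¹ * ∑ i, ‖x i‖ ^ (2 + δ) ≤ M → (∀ k, sampleMean x k ≤ K / √n) →
      |(drawLaw n (R n)).real {π | critVal (R n) α x < qStat x π} - α| ≤ η := by
  obtain ⟨C, hC, N, hN⟩ := exists_uStat_anticoncentration hm (M := M) hδ hL hV
  have hm' : (0 : ℝ) < m := by exact_mod_cast hm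
  -- Once `ε` is fixed by the anticoncentration term, the two remaining errors, of order `1/R` and
  -- `1/n`, each fall below `η/4`.
  obtain ⟨ε, hε, hεη⟩ : ∃ ε > 0, m * (C * ε) = η / 4 :=
    ⟨η / (4 * (m * C)), by positivity, by field_simp⟩
  have hRinv : Tendsto (fun n => m * (C * (1 / ((R n : ℝ) * ε ^ 2)))) atTop (𝓝 0) := by
    have h1 : Tendsto (fun n => ((R n : ℝ))⁻¹) atTop (𝓝 0) :=
      tendsto_inv_atTop_zero.comp (tendsto_natCast_atTop_atTop.comp hR)
    have h2 := h1.const_mul (m * (C * (1 / ε ^ 2)))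
    rw [mul_zero] at h2
    refine h2.congr fun n => ?_
    field_simp
  have hninv : Tendsto (fun n : ℕ => m * (16 * K ^ 2 / (L * ε ^ 2) * (1 / (n : ℝ)))) atTop (𝓝 0) := by
    simpa using (tendsto_one_div_atTop_nhds_zero_nat.const_mul (16 * K ^ 2 / (L * ε ^ 2))).const_mul
      (m : ℝ)
  have hbias : Tendsto (fun n : ℕ => √(R n : ℝ) / n * (K ^ 2 / L)) atTop (𝓝 0) := by
    simpa using hRn.mul_const (K ^ 2 / L)
  filter_upwards [eventually_ge_atTop N, eventually_ge_atTop 2, hR.eventually_gt_atTop 0,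
    hRinv.eventually_le_const (by positivity : 0 < η / 4),
    hninv.eventually_le_const (by positivity : 0 < η / 4),
    hbias.eventually_le_const (by positivity : 0 < ε / 2)] with n hnN hn2 hRpos h1 h2 h3 x hxL hxV hxM hxK
  refine (abs_measureReal_critVal_lt_sub_le hα x hε).trans ?_
  have hA : (drawLaw n (R n)).real {π | |qTilde x π - critVal (R n) α x| ≤ ε} ≤ η / 2 := by
    refine (measureReal_qTilde_le_sum hm x _ ε).trans ?_
    refine (Finset.sum_le_card_nsmul _ _ _ fun k _ =>
      hN n hnN (R n) hRpos x k (hxL k) (hxV k) hxM ε hε _).trans ?_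
    rw [Finset.card_univ, Fintype.card_fin, nsmul_eq_mul, mul_add, mul_add, hεη]
    linarith
  have hB : (drawLaw n (R n)).real {π | ε < |qStat x π - qTilde x π|} ≤ η / 4 := by
    refine (measureReal_qStat_sub_qTilde_le_sum hm x hε).trans ?_
    refine (Finset.sum_le_card_nsmul _ _ (16 * K ^ 2 / (L * ε ^ 2) * (1 / n)) fun k _ => ?_).trans ?_
    · by_cases h0 : 0 ≤ sampleMean x k
      · simp only [h0, true_and]
        exact measureReal_lambdaHat_gt_le hm hn2 hRpos x k hL hε (hxL k) h0 (hxK k) h3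
      · simp only [h0, false_and]
        simp only [Set.ofPred_false, measureReal_empty]
        positivity
    · rw [Finset.card_univ, Fintype.card_fin, nsmul_eq_mul]
      exact h2
  linarith

/-! ### Measurability -/

theorem measurable_uStat {n m R : ℕ} (k : Fin m) {μ : (Fin n → Fin m → ℝ) → ℝ} (hμ : Measurable μ)
    (π : Fin R → Equiv.Perm (Fin n)) :
    Measurable fun x : Fin n → Fin m → ℝ => uStat x k (μ x) π := by
  have hdraw : ∀ (σ : Equiv.Perm (Fin n)) (j : ℕ),
      Measurable fun x : Fin n → Fin m → ℝ => draw x σ j k := by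
    intro σ j
    unfold draw obs
    split_ifs <;> fun_prop
  have hv : Measurable fun x : Fin n → Fin m → ℝ => sampleVar x k k := by
    simp only [sampleVar_diag, sampleMean_apply]
    fun_prop
  unfold uStat
  fun_prop

theorem measurable_sampleMean {n m : ℕ} (k : Fin m) :
    Measurable fun x : Fin n → Fin m → ℝ => sampleMean x k := by
  simp only [sampleMean_apply]
  fun_prop

theorem measurable_qTilde {n m R : ℕ} (π : Fin R → Equiv.Perm (Fin n)) :
    Measurable fun x : Fin n → Fin m → ℝ => qTilde x π :=
  Measurable.iSup fun k => measurable_uStat k (measurable_sampleMean k) π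

theorem measurable_qStat {n m R : ℕ} (π : Fin R → Equiv.Perm (Fin n)) :
    Measurable fun x : Fin n → Fin m → ℝ => qStat x π := by
  refine Measurable.iSup fun k => (measurable_uStat k measurable_const π).sub ?_
  refine Measurable.ite (measurableSet_lt (measurable_sampleMean k) measurable_const) ?_
    measurable_const
  have : (fun x : Fin n → Fin m → ℝ => lambdaHat x k π)
      = fun x => uStat x k 0 π - uStat x k (sampleMean x k) π := by
    ext x
    rw [← uStat_sub_lambdaHat, sub_sub_cancel]
  rw [this]
  exact (measurable_uStat k measurable_const π).sub
    (measurable_uStat k (measurable_sampleMean k) π)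

theorem measurable_critVal {n m : ℕ} (R : ℕ) {α : ℝ} (hα : α ∈ Set.Ioo (0 : ℝ) 1) :
    Measurable fun x : Fin n → Fin m → ℝ => critVal R α x := by
  refine measurable_of_Iio fun c => ?_
  have : (fun x : Fin n → Fin m → ℝ => critVal R α x) ⁻¹' Set.Iio c
      = ⋃ d : ℚ, {x | (d : ℝ) < c ∧ 1 - α ≤ (drawLaw n R).real {π | qTilde x π ≤ d}} := by
    ext x
    simp only [Set.mem_preimage, Set.mem_Iio, Set.mem_iUnion, Set.mem_ofPred_eq]
    exact critVal_lt_iff hα x c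
  rw [this]
  refine MeasurableSet.iUnion fun d => (MeasurableSet.const _).inter ?_
  have hq : Measurable fun p : (Fin n → Fin m → ℝ) × (Fin R → Equiv.Perm (Fin n)) =>
      qTilde p.1 p.2 := measurable_from_prod_countable_left measurable_qTilde
  have hset : MeasurableSet {p : (Fin n → Fin m → ℝ) × (Fin R → Equiv.Perm (Fin n)) |
      qTilde p.1 p.2 ≤ d} := measurableSet_le hq measurable_const
  have hreal : Measurable fun x : Fin n → Fin m → ℝ =>
      (drawLaw n R).real {π | qTilde x π ≤ d} :=
    (measurable_measure_prodMk_left hset).ennreal_toReal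
  exact measurableSet_le measurable_const hreal

theorem measurableSet_critVal_lt_qStat {n m R : ℕ} {α : ℝ} (hα : α ∈ Set.Ioo (0 : ℝ) 1) :
    MeasurableSet {p : (Fin n → Fin m → ℝ) × (Fin R → Equiv.Perm (Fin n)) |
      critVal R α p.1 < qStat p.1 p.2} := by
  have h1 : Measurable fun p : (Fin n → Fin m → ℝ) × (Fin R → Equiv.Perm (Fin n)) =>
      critVal R α p.1 := (measurable_critVal R hα).comp measurable_fst
  have h2 : Measurable fun p : (Fin n → Fin m → ℝ) × (Fin R → Equiv.Perm (Fin n)) =>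
      qStat p.1 p.2 := measurable_from_prod_countable_left measurable_qStat
  exact measurableSet_lt h1 h2

variable {Ω : Type*} [MeasurableSpace Ω] {m : ℕ}

theorem measurable_sample {X : (n : ℕ) → Fin n → Ω → Fin m → ℝ} (hX : ∀ n i, Measurable (X n i))
    (n : ℕ) : Measurable (sample X n) :=
  measurable_pi_lambda _ fun i => hX n i

/-- Independence is built into the product measure, so Fubini reduces the test to fixed data. -/
theorem rejProb_eq {X : (n : ℕ) → Fin n → Ω → Fin m → ℝ} (hX : ∀ n i, Measurable (X n i))
    {α : ℝ} (hα : α ∈ Set.Ioo (0 : ℝ) 1) (n R : ℕ) (P : ProbabilityMeasure Ω) :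
    rejProb X α n R P
      = ∫ ω, (drawLaw n R).real {π | critVal R α (sample X n ω) < qStat (sample X n ω) π}
          ∂(P : Measure Ω) := by
  have hset : MeasurableSet {z : Ω × (Fin R → Equiv.Perm (Fin n)) |
      critVal R α (sample X n z.1) < qStat (sample X n z.1) z.2} := by
    have h1 : Measurable fun z : Ω × (Fin R → Equiv.Perm (Fin n)) =>
        critVal R α (sample X n z.1) :=
      (measurable_critVal R hα).comp ((measurable_sample hX n).comp measurable_fst)
    have h2 : Measurable fun z : Ω × (Fin R → Equiv.Perm (Fin n)) =>
        qStat (sample X n z.1) z.2 :=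
      measurable_from_prod_countable_left fun π => (measurable_qStat π).comp (measurable_sample hX n)
    exact measurableSet_lt h1 h2
  have hfun : (fun z : Ω × (Fin R → Equiv.Perm (Fin n)) => testFn α (sample X n z.1) z.2)
      = {z | critVal R α (sample X n z.1) < qStat (sample X n z.1) z.2}.indicator (fun _ => 1) := by
    ext z
    simp [testFn, Set.indicator_apply]
  rw [rejProb, hfun, integral_prod _ ((integrable_const (1 : ℝ)).indicator hset)]
  refine integral_congr_ae (ae_of_all _ fun ω => ?_)
  simp only
  rw [← integral_indicator_one (MeasurableSet.of_discrete
    (s := {π : Fin R → Equiv.Perm (Fin n) | critVal R α (sample X n ω) < qStat (sample X n ω) π}))]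
  refine integral_congr_ae (ae_of_all _ fun π => ?_)
  simp [Set.indicator_apply]

theorem measurable_condRejProb {X : (n : ℕ) → Fin n → Ω → Fin m → ℝ}
    (hX : ∀ n i, Measurable (X n i)) {α : ℝ} (hα : α ∈ Set.Ioo (0 : ℝ) 1) (n R : ℕ) :
    Measurable fun ω =>
      (drawLaw n R).real {π | critVal R α (sample X n ω) < qStat (sample X n ω) π} :=
  ((measurable_measure_prodMk_left (measurableSet_critVal_lt_qStat hα)).ennreal_toReal).comp
    (measurable_sample hX n)

theorem rejProb_le_one {X : (n : ℕ) → Fin n → Ω → Fin m → ℝ} (hX : ∀ n i, Measurable (X n i))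
    {α : ℝ} (hα : α ∈ Set.Ioo (0 : ℝ) 1) (n R : ℕ) (P : ProbabilityMeasure Ω) :
    rejProb X α n R P ≤ 1 := by
  rw [rejProb_eq hX hα]
  refine (integral_mono_of_nonneg (ae_of_all _ fun ω => measureReal_nonneg) (integrable_const 1)
    (ae_of_all _ fun ω => measureReal_le_one)).trans ?_
  simp

/-- The rejection probability is within `η` plus the probability of irregular data of the level. -/
theorem abs_rejProb_sub_le {X : (n : ℕ) → Fin n → Ω → Fin m → ℝ} (hX : ∀ n i, Measurable (X n i))
    {α : ℝ} (hα : α ∈ Set.Ioo (0 : ℝ) 1) (n R : ℕ) (P : ProbabilityMeasure Ω) {η : ℝ} (hη : 0 ≤ η) :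
    |rejProb X α n R P - α| ≤ η + (P : Measure Ω).real {ω | η <
      |(drawLaw n R).real {π | critVal R α (sample X n ω) < qStat (sample X n ω) π} - α|} := by
  set f : Ω → ℝ := fun ω =>
    (drawLaw n R).real {π | critVal R α (sample X n ω) < qStat (sample X n ω) π}
  have hf : Measurable f := measurable_condRejProb hX hα n R
  have hf0 : ∀ ω, 0 ≤ f ω := fun ω => measureReal_nonneg
  have hf1 : ∀ ω, f ω ≤ 1 := fun ω => measureReal_le_one
  have hfi : Integrable f (P : Measure Ω) :=
    Integrable.of_bound (C := 1) hf.aestronglyMeasurable (ae_of_all _ fun ω => by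
      rw [Real.norm_eq_abs, abs_of_nonneg (hf0 ω)]
      exact hf1 ω)
  have hset : MeasurableSet {ω | η < |f ω - α|} :=
    measurableSet_lt measurable_const (by fun_prop)
  rw [rejProb_eq hX hα]
  have h1 : ∫ ω, f ω ∂(P : Measure Ω) - α = ∫ ω, (f ω - α) ∂(P : Measure Ω) := by
    rw [integral_sub hfi (integrable_const _)]
    simp
  have hind : Integrable ({ω | η < |f ω - α|}.indicator (1 : Ω → ℝ)) (P : Measure Ω) :=
    (integrable_const (1 : ℝ)).indicator hset
  calc |∫ ω, f ω ∂(P : Measure Ω) - α| = ‖∫ ω, (f ω - α) ∂(P : Measure Ω)‖ := by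
        rw [h1, Real.norm_eq_abs]
    _ ≤ ∫ ω, ‖f ω - α‖ ∂(P : Measure Ω) := norm_integral_le_integral_norm _
    _ ≤ ∫ ω, (η + {ω | η < |f ω - α|}.indicator (1 : Ω → ℝ) ω) ∂(P : Measure Ω) := by
        refine integral_mono (hfi.sub (integrable_const _)).norm ((integrable_const η).add hind)
          fun ω => ?_
        rw [Real.norm_eq_abs]
        by_cases hω : ω ∈ {ω | η < |f ω - α|}
        · rw [Set.indicator_of_mem hω, Pi.one_apply]
          have : |f ω - α| ≤ 1 := by
            rw [abs_le]
            constructor <;> linarith [hf0 ω, hf1 ω, hα.1, hα.2]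
          linarith
        · rw [Set.indicator_of_notMem hω, add_zero]
          exact not_lt.mp hω
    _ = _ := by
        rw [integral_add (integrable_const η) hind, integral_indicator_one hset]
        simp [f]

/-! ### Null classes -/

theorem abs_apply_le_maxNorm (S : Matrix (Fin m) (Fin m) ℝ) (i j : Fin m) :
    |S i j| ≤ maxNorm S :=
  (le_ciSup (f := fun j => |S i j|) (Set.finite_range _).bddAbove j).trans
    (le_ciSup (f := fun i => ⨆ j, |S i j|) (Set.finite_range _).bddAbove i)

/-- A diagonal entry is a convex combination of the eigenvalues, weighted by the squared entries of
a row of the orthogonal eigenvector matrix. -/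
theorem le_diag_of_le_eigenvalues {S : Matrix (Fin m) (Fin m) ℝ} (hS : S.IsHermitian) {L : ℝ}
    (hL : ∀ k, L ≤ hS.eigenvalues k) (k : Fin m) : L ≤ S k k := by
  set U : Matrix (Fin m) (Fin m) ℝ := hS.eigenvectorUnitary.1
  have hspec : S = U * Matrix.diagonal hS.eigenvalues * star U := by
    have h := hS.spectral_theorem
    rw [Unitary.conjStarAlgAut_apply] at h
    exact h
  have hone : U * star U = 1 := Unitary.mul_star_self_of_mem hS.eigenvectorUnitary.2
  have h1 : ∑ j, U k j * U k j = 1 := by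
    have := congrFun (congrFun hone k) k
    simpa [Matrix.mul_apply, Matrix.star_apply] using this
  have h2 : S k k = ∑ j, hS.eigenvalues j * (U k j * U k j) := by
    conv_lhs => rw [hspec]
    rw [Matrix.mul_apply]
    refine Finset.sum_congr rfl fun j _ => ?_
    rw [Matrix.mul_diagonal, Matrix.star_apply]
    simp only [star_trivial]
    ring
  rw [h2, ← mul_one L, ← h1, Finset.mul_sum]
  exact Finset.sum_le_sum fun j _ =>
    mul_le_mul_of_nonneg_right (hL j) (mul_self_nonneg _)

/-- Along every sequence in a null class the rejection probability tends to the nominal level. -/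
theorem tendsto_rejProb (hm : 0 < m) {X : (n : ℕ) → Fin n → Ω → Fin m → ℝ}
    (hX : ∀ n i, Measurable (X n i)) {P₀ : Set (ProbabilityMeasure Ω)} (hP₀ : IsNullClass X P₀)
    {α : ℝ} (hα : α ∈ Set.Ioo (0 : ℝ) 1) {R : ℕ → ℕ} (hR : Tendsto R atTop atTop)
    (hRn : Tendsto (fun n : ℕ => √(R n : ℝ) / n) atTop (𝓝 0))
    {P : ℕ → ProbabilityMeasure Ω} (hP : ∀ n, P n ∈ P₀) :
    Tendsto (fun n => rejProb X α n (R n) (P n)) atTop (𝓝 α) := by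
  obtain ⟨-, δ, L, U, hδ, hL, hU, hseq⟩ := hP₀
  obtain ⟨hmean, ⟨S, hS, hvar⟩, hmom, hnull⟩ := hseq P hP
  rw [Metric.tendsto_nhds]
  intro ε hε
  -- One share for regular data and one for each of the three irregular events, `ε/2` in total.
  have hη : 0 < ε / 8 := by positivity
  obtain ⟨K, hK⟩ := hmean (ε / 8) hη
  obtain ⟨M, hM⟩ := hmom (ε / 8) hη
  filter_upwards [hK, hM, (hvar (L / 2) (by positivity)).eventually_le_const hη,
    eventually_gt_atTop 0,
    eventually_abs_measureReal_critVal_lt_sub_le hm hα hR hRn hδ (half_pos hL)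
      (by positivity : 0 < U + L / 2) M K hη] with n h1 h2 h3 hn0 hdata
  have hn' : (0 : ℝ) < n := by exact_mod_cast hn0
  rw [Real.dist_eq]
  refine (abs_rejProb_sub_le hX hα n (R n) (P n) hη.le).trans_lt ?_
  have hsub : {ω | ε / 8 < |(drawLaw n (R n)).real
        {π | critVal (R n) α (sample X n ω) < qStat (sample X n ω) π} - α|}
      ⊆ ({ω | K < ‖(√(n : ℝ))⁻¹ • ∑ i, (X n i ω - mean X n (P n))‖}
        ∪ {ω | M < ‖(n : ℝ)⁻¹ * ∑ i, ‖X n i ω‖ ^ (2 + δ)‖})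
        ∪ {ω | L / 2 ≤ maxNorm (sampleVar (sample X n ω) - S n)} := by
    intro ω hω
    by_contra hnot
    simp only [Set.mem_union, Set.mem_ofPred_eq, not_or, not_lt, not_le] at hnot
    obtain ⟨⟨hn1, hn2⟩, hn3⟩ := hnot
    refine absurd (show ε / 8 < _ from hω) (not_lt.mpr (hdata (sample X n ω) ?_ ?_ ?_ ?_))
    · intro k
      obtain ⟨-, hherm, heig⟩ := hS n
      have hd := le_diag_of_le_eigenvalues hherm (fun k => (heig k).le) k
      have := (abs_apply_le_maxNorm (sampleVar (sample X n ω) - S n) k k).trans_lt hn3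
      rw [Matrix.sub_apply, abs_lt] at this
      linarith [this.1]
    · intro k
      have hd := (le_abs_self _).trans_lt ((abs_apply_le_maxNorm (S n) k k).trans_lt (hS n).1)
      have := (abs_apply_le_maxNorm (sampleVar (sample X n ω) - S n) k k).trans_lt hn3
      rw [Matrix.sub_apply, abs_lt] at this
      linarith [this.2]
    · exact (le_abs_self _).trans hn2
    · intro k
      have hk := (norm_le_pi_norm _ k).trans hn1
      rw [Real.norm_eq_abs] at hk
      have hk' := (le_abs_self _).trans hk
      simp only [Pi.smul_apply, Finset.sum_apply, Pi.sub_apply, smul_eq_mul,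
        Finset.sum_sub_distrib, Finset.sum_const, Finset.card_univ, Fintype.card_fin,
        nsmul_eq_mul, Pi.mul_apply, Pi.natCast_apply] at hk'
      rw [inv_mul_le_iff₀ (by positivity)] at hk'
      -- The null enters here: a nonpositive mean turns `√n`-consistency into the one-sided bound
      -- `K/√n` on the sample mean.
      have hneg : (n : ℝ) * mean X n (P n) k ≤ 0 :=
        mul_nonpos_of_nonneg_of_nonpos hn'.le (hnull n k)
      rw [sampleMean_apply, inv_mul_le_iff₀ hn']
      have hsq : (n : ℝ) * (K / √n) = √n * K := by
        rw [mul_div_left_comm, Real.div_sqrt, mul_comm]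
      rw [hsq]
      simp only [sample]
      linarith
  have hle := (measureReal_mono (μ := (P n : Measure Ω)) hsub).trans
    ((measureReal_union_le _ _).trans (add_le_add_left (measureReal_union_le _ _) _))
  linarith

end ResampledMI

/-! ### From sequences to the supremum over the class -/

theorem theorem2 {Ω : Type*} [MeasurableSpace Ω] {m : ℕ} (hm : 0 < m)
    (X : (n : ℕ) → Fin n → Ω → Fin m → ℝ) (hX : ∀ n i, Measurable (X n i))
    (P₀ : Set (ProbabilityMeasure Ω)) (hne : P₀.Nonempty) (hP₀ : ResampledMI.IsNullClass X P₀)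
    (α : ℝ) (hα : α ∈ Set.Ioo (0 : ℝ) 1)
    (R : ℕ → ℕ) (hR : Tendsto R atTop atTop)
    (hRn : Tendsto (fun n : ℕ => √(R n : ℝ) / n) atTop (𝓝 0)) :
    Tendsto (fun n => ⨆ P : P₀, ResampledMI.rejProb X α n (R n) P) atTop (𝓝 α) := by
  classical
  obtain ⟨P₁, hP₁⟩ := hne
  have : Nonempty P₀ := ⟨⟨P₁, hP₁⟩⟩
  rw [Metric.tendsto_nhds]
  intro ε hε
  -- a sequence of measures that violates the bound whenever some measure in the class does
  have hchoose : ∀ n, ∃ Q ∈ P₀, (∃ P ∈ P₀, ε / 2 < |ResampledMI.rejProb X α n (R n) P - α|) →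
      ε / 2 < |ResampledMI.rejProb X α n (R n) Q - α| := by
    intro n
    by_cases h : ∃ P ∈ P₀, ε / 2 < |ResampledMI.rejProb X α n (R n) P - α|
    · obtain ⟨Q, hQ, hQ'⟩ := h
      exact ⟨Q, hQ, fun _ => hQ'⟩
    · exact ⟨P₁, hP₁, fun h' => absurd h' h⟩
  choose Q hQ hQ' using hchoose
  have hlim := ResampledMI.tendsto_rejProb hm hX hP₀ hα hR hRn hQ
  rw [Metric.tendsto_nhds] at hlim
  filter_upwards [hlim (ε / 2) (half_pos hε)] with n hn
  rw [Real.dist_eq] at hn ⊢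
  have hall : ∀ P : P₀, |ResampledMI.rejProb X α n (R n) P - α| ≤ ε / 2 := by
    intro P
    by_contra! h
    exact absurd hn (not_lt.mpr (hQ' n ⟨P, P.2, h⟩).le)
  -- Boundedness keeps the real supremum from taking its default value; the lower bound needs only
  -- the one member `P₁`.
  have hbdd : BddAbove (Set.range fun P : P₀ => ResampledMI.rejProb X α n (R n) P) := by
    refine ⟨1, ?_⟩
    rintro _ ⟨P, rfl⟩
    exact ResampledMI.rejProb_le_one hX hα n (R n) P
  have hup : (⨆ P : P₀, ResampledMI.rejProb X α n (R n) P) ≤ α + ε / 2 :=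
    ciSup_le fun P => by linarith [(abs_le.mp (hall P)).2]
  have hlow : α - ε / 2 ≤ ⨆ P : P₀, ResampledMI.rejProb X α n (R n) P :=
    le_ciSup_of_le hbdd ⟨P₁, hP₁⟩ (by linarith [(abs_le.mp (hall ⟨P₁, hP₁⟩)).1])
  rw [abs_lt]
  constructor <;> linarith
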